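/- There exist a countable first-order language $L$ and a complete (consistent) $L$-theory $T$ such that: 1. $T$ is bounded, i.e. $\forall_n$-axiomatizable for some finite $n$; in fact $T$ is $\forall_1$-axiomatizable (hence also $\forall_2$-axiomatizable); 2. $T$ has a complete $1$-type $p(x)\in S_1(T)$ that is unbounded, i.e. not $\forall_n$-axiomatizable for any finite $n$; 3. $T$ is strictly superstable, i.e. superstable but not $\omega$-stable. Here $\forall_0=\exists_0$ is the set of quantifier-free formulas, a $\forall_{n+1}$-formula is a (possibly empty) block of universal quantifiers in front of an $\exists_n$-formula, and an $\exists_{n+1}$-formula is a (possibly empty) block of existential quantifiers in front of a $\forall_n$-formula. A theory is $\forall_n$-axiomatizable if it is logically equivalent to a set of $\forall_n$-sentences. A type $p(x)$ is regarded as the theory $p(a)$ in the language $L\cup\{a\}$, where $a$ is a new constant symbol. $T$ is $\kappa$-stable if over every set of at most $\kappa$ parameters in a model of $T$ there are at most $\kappa$ complete $1$-types; $T$ is $\omega$-stable if it is $\aleph_0$-stable, and superstable if it is $\kappa$-stable for every $\kappa\ge 2^{|T|}$, where $|T|=\max(\aleph_0,|L|)$ (so here for every $\kappa\ge 2^{\aleph_0}$).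 -/

import Mathlib

open Cardinal FirstOrder

namespace FirstOrder.Language

universe u v w

namespace BoundedFormula

variable {L : Language.{u, v}} {α : Type w}

/-- `AllBlock P l φ`: the formula `φ` is `∀ x₁ … ∀ xₖ ψ` for a (possibly empty) block of universal
quantifiers and a formula `ψ` with property `P`. -/
inductive AllBlock (P : ∀ l : ℕ, L.BoundedFormula α l → Prop) :
    ∀ l : ℕ, L.BoundedFormula α l → Prop
  | base {l : ℕ} {φ : L.BoundedFormula α l} (h : P l φ) : AllBlock P l φ
  | all {l : ℕ} {φ : L.BoundedFormula α (l + 1)} (h : AllBlock P (l + 1) φ) :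
      AllBlock P l φ.all

/-- `ExBlock P l φ`: the formula `φ` is `∃ x₁ … ∃ xₖ ψ` for a (possibly empty) block of existential
quantifiers and a formula `ψ` with property `P`. -/
inductive ExBlock (P : ∀ l : ℕ, L.BoundedFormula α l → Prop) :
    ∀ l : ℕ, L.BoundedFormula α l → Prop
  | base {l : ℕ} {φ : L.BoundedFormula α l} (h : P l φ) : ExBlock P l φ
  | ex {l : ℕ} {φ : L.BoundedFormula α (l + 1)} (h : ExBlock P (l + 1) φ) :
      ExBlock P l φ.ex

mutual

/-- The `∀ₙ`-formulas: `∀₀` is quantifier-free, and a `∀ₙ₊₁`-formula is a block of universal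
quantifiers in front of an `∃ₙ`-formula. -/
def IsForallLevel : ℕ → ∀ l : ℕ, L.BoundedFormula α l → Prop
  | 0 => fun _ φ => φ.IsQF
  | n + 1 => AllBlock (IsExistsLevel n)

/-- The `∃ₙ`-formulas: `∃₀` is quantifier-free, and an `∃ₙ₊₁`-formula is a block of existential
quantifiers in front of a `∀ₙ`-formula. -/
def IsExistsLevel : ℕ → ∀ l : ℕ, L.BoundedFormula α l → Prop
  | 0 => fun _ φ => φ.IsQF
  | n + 1 => ExBlock (IsForallLevel n)

end

end BoundedFormula

namespace Theory

/-- `T` is `∀ₙ`-axiomatizable: it is logically equivalent to a set of `∀ₙ`-sentences. -/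
def IsForallAxiomatizable {L : Language.{u, v}} (n : ℕ) (T : L.Theory) : Prop :=
  ∃ Γ : L.Theory, (∀ φ ∈ Γ, BoundedFormula.IsForallLevel n 0 φ) ∧
    (∀ φ ∈ Γ, T ⊨ᵇ φ) ∧ (∀ φ ∈ T, Γ ⊨ᵇ φ)

/-- `T` is bounded: it is `∀ₙ`-axiomatizable for some finite `n`. -/
def IsBounded {L : Language.{u, v}} (T : L.Theory) : Prop :=
  ∃ n : ℕ, T.IsForallAxiomatizable n

/-- `T` is `κ`-stable: over every set `A` of at most `κ` parameters in a model `M` of `T` there are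
at most `κ` complete `1`-types. A complete type over `A` in `M` is a complete type over the theory
of `M` in the language with a constant for each element of `A`. -/
def IsStableIn {L : Language.{u, u}} (T : L.Theory) (κ : Cardinal.{u}) : Prop :=
  ∀ (M : Type u) [L.Structure M] [Nonempty M] [M ⊨ T] (A : Set M), #A ≤ κ →
    #((L[[A]].completeTheory M).CompleteType (Fin 1)) ≤ κ

/-- `T` is `ω`-stable. -/
def IsOmegaStable {L : Language.{u, u}} (T : L.Theory) : Prop :=
  T.IsStableIn ℵ₀

/-- `T` is superstable: it is `κ`-stable for every `κ ≥ 2 ^ |T|`, where `|T|` is the number of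
formulas of the language (the number of symbols, or `ℵ₀` if that is larger). -/
def IsSuperstable {L : Language.{u, u}} (T : L.Theory) : Prop :=
  ∀ κ : Cardinal.{u}, 2 ^ max ℵ₀ L.card ≤ κ → T.IsStableIn κ

end Theory

end FirstOrder.Language

-- The models are chains of equivalence relations `E 0 ⊆ E 1 ⊆ …`, with `E 0` equality, in which the
-- constants name a copy of `Point`: infinitely many copies of each finite component, such that
-- anything equivalent to a constant is again a constant. As components are finite, all of this is
-- universal (`good_of_model`), and it puts no restriction on the rest of the model: any nested
-- structure may be added to the points (`good_withPoints`).
--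
-- Completeness and stability rest on colours, which count subclasses up to a threshold `q`, level
-- by level. Every colour already occurs in a finite structure, hence in infinitely many components
-- (`exists_point_col`, `Good.col_trunc_succ_iff`). So any two good structures, cut off above level
-- `k`, agree at the top, and an Ehrenfeucht–Fraïssé argument (`exists_match_cons`,
-- `exists_realize_iff_of_match`) shows that formulas see only colours and equivalences. For
-- sentences this is completeness. For a type over `A` there remain the colours and a nearest
-- parameter or constant (`exists_invariant`), so there are at most `(|A| + ℵ₀) · 2 ^ ℵ₀` types.
-- Conversely, for each `s ⊆ ℕ` an added element can have an `E (i + 1)`-class that splits exactly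
-- for `i ∈ s`, which gives `2 ^ ℵ₀` types over `∅`.
--
-- For the unbounded type, trees are added whose classes have kinds `A` and `B`, with `A` forbidding
-- and `B` allowing subclasses of kind `A`. A `∀ₙ`-formula cannot tell these kinds apart at levels
-- that are high compared to `n` (`LabelRel`, `Position.realize_imp`), although a formula whose
-- complexity grows with the level can (`alternating_iff`). Allowing subclasses of kind `A` at one
-- high level beside the base sequence therefore preserves the `∀ₙ`-part of its type, but changes
-- the type (`hasSubclassA_baseSeq_iff`).

namespace NestedEquiv

-- Nested equivalence relations

/-- A sequence of coarser and coarser equivalence relations that starts with equality. -/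
structure Nested {X : Type} (E : ℕ → X → X → Prop) : Prop where
  equiv : ∀ j, Equivalence (E j)
  mono_succ : ∀ {j x y}, E j x y → E (j + 1) x y
  eq_of_zero : ∀ {x y}, E 0 x y → x = y

namespace Nested

variable {X : Type} {E : ℕ → X → X → Prop} (h : Nested E)
include h

theorem refl (j : ℕ) (x : X) : E j x x := (h.equiv j).refl x

theorem symm {j : ℕ} {x y : X} (hxy : E j x y) : E j y x := (h.equiv j).symm hxy

theorem trans {j : ℕ} {x y z : X} (hxy : E j x y) (hyz : E j y z) : E j x z :=
  (h.equiv j).trans hxy hyz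

theorem mono {i j : ℕ} (hij : i ≤ j) {x y : X} (hxy : E i x y) : E j x y := by
  induction hij with
  | refl => exact hxy
  | step _ ih => exact h.mono_succ ih

theorem congr_left {j : ℕ} {x y z : X} (hxy : E j x y) : E j x z ↔ E j y z :=
  ⟨h.trans (h.symm hxy), h.trans hxy⟩

theorem congr_right {j : ℕ} {x y z : X} (hxy : E j x y) : E j z x ↔ E j z y :=
  ⟨fun hz => h.trans hz hxy, fun hz => h.trans hz (h.symm hxy)⟩

theorem comap {Y : Type} {f : Y → X} (hf : Function.Injective f) :
    Nested fun j y y' => E j (f y) (f y') where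
  equiv j := ⟨fun _ => h.refl j _, fun hy => h.symm hy, fun hy hz => h.trans hy hz⟩
  mono_succ hy := h.mono_succ hy
  eq_of_zero hy := hf (h.eq_of_zero hy)

end Nested

/-- Agreement of keyed sequences from the index `j` on. -/
def TailEq {K B : Type} (j : ℕ) (x y : K × (ℕ → B)) : Prop :=
  x.1 = y.1 ∧ ∀ i, j ≤ i → x.2 i = y.2 i

theorem nested_tailEq (K B : Type) : Nested (TailEq (K := K) (B := B)) where
  equiv j := ⟨fun _ => ⟨rfl, fun _ _ => rfl⟩, fun h => ⟨h.1.symm, fun i hi => (h.2 i hi).symm⟩,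
    fun h h' => ⟨h.1.trans h'.1, fun i hi => (h.2 i hi).trans (h'.2 i hi)⟩⟩
  mono_succ h := ⟨h.1, fun i hi => h.2 i (by omega)⟩
  eq_of_zero h := Prod.ext h.1 (funext fun i => h.2 i (Nat.zero_le i))

-- Colours and the back-and-forth step

/-- The colours of the classes of the `j`-th relation: for each colour of the classes of the
preceding relation, which numbers up to `q` of subclasses of that colour there are. -/
def Color (q : ℕ) : ℕ → Type
  | 0 => Unit
  | j + 1 => Color q j → Fin (q + 1) → Prop

instance finite_color (q : ℕ) : ∀ j, Finite (Color q j)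
  | 0 => inferInstanceAs (Finite Unit)
  | j + 1 =>
    have := finite_color q j
    inferInstanceAs (Finite (Color q j → Fin (q + 1) → Prop))

/-- The colour of the class of `x` for the `j`-th relation. -/
def col {X : Type} (E : ℕ → X → X → Prop) (q : ℕ) : ∀ j, X → Color q j
  | 0, _ => ()
  | j + 1, x => fun γ m => ∃ y : Fin m → X, (∀ i, E (j + 1) (y i) x ∧ col E q j (y i) = γ) ∧
      ∀ i i', E j (y i) (y i') → i = i'

theorem col_succ {X : Type} (E : ℕ → X → X → Prop) (q j : ℕ) (x : X) (γ : Color q j)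
    (m : Fin (q + 1)) : col E q (j + 1) x γ m ↔
      ∃ y : Fin m → X, (∀ i, E (j + 1) (y i) x ∧ col E q j (y i) = γ) ∧
        ∀ i i', E j (y i) (y i') → i = i' := Iff.rfl

section

variable {X Y : Type} {E : ℕ → X → X → Prop} {E' : ℕ → Y → Y → Prop}

theorem col_congr (h : Nested E) (q : ℕ) {j : ℕ} {x y : X} (hxy : E j x y) :
    col E q j x = col E q j y := by
  cases j with
  | zero => rfl
  | succ j =>
    funext γ m
    refine propext ?_
    simp only [col_succ, h.congr_right hxy]

/-- Colours are preserved by embeddings whose range is a union of classes. -/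
theorem col_map (h' : Nested E') (q k : ℕ) (e : X → Y)
    (he : ∀ j ≤ k, ∀ x x', E' j (e x) (e x') ↔ E j x x')
    (hcl : ∀ x y, E' k y (e x) → y ∈ Set.range e) :
    ∀ j ≤ k, ∀ x, col E' q j (e x) = col E q j x := by
  intro j
  induction j with
  | zero => intros; rfl
  | succ j ih =>
    intro hj x
    funext γ m
    refine propext ?_
    rw [col_succ, col_succ]
    constructor
    · rintro ⟨y, hy, hy'⟩
      choose z hz using fun i => hcl x (y i) (h'.mono hj (hy i).1)
      obtain rfl : y = fun i => e (z i) := funext fun i => (hz i).symm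
      refine ⟨z, fun i => ⟨(he _ hj _ _).1 (hy i).1, ?_⟩,
        fun i i' hi => hy' i i' ((he _ (by omega) _ _).2 hi)⟩
      rw [← ih (by omega)]
      exact (hy i).2
    · rintro ⟨y, hy, hy'⟩
      refine ⟨fun i => e (y i), fun i => ⟨(he _ hj _ _).2 (hy i).1, ?_⟩,
        fun i i' hi => hy' i i' ((he _ (by omega) _ _).1 hi)⟩
      rw [ih (by omega)]
      exact (hy i).2

/-- An element near `x` has a counterpart near any `y` of the same colour as `x`. -/
theorem exists_col_eq (h : Nested E) (h' : Nested E') {q : ℕ} (hq : 1 ≤ q) {j : ℕ} {x x₁ : X}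
    {y : Y} (hxy : col E q j x = col E' q j y) (hx : E j x₁ x) :
    ∃ y₁, E' j y₁ y ∧ ∀ i ≤ j, col E q i x₁ = col E' q i y₁ := by
  induction j generalizing x y with
  | zero =>
    refine ⟨y, h'.refl _ _, fun i hi => ?_⟩
    obtain rfl : i = 0 := by omega
    rfl
  | succ j ih =>
    -- The subclass of `x₁` witnesses its own colour with count 1, a count that is recorded because
    -- `1 ≤ q`.
    have h1 : col E q (j + 1) x (col E q j x₁) ⟨1, by omega⟩ :=
      ⟨fun _ => x₁, fun _ => ⟨hx, rfl⟩, fun i i' _ => Subsingleton.elim (α := Fin 1) i i'⟩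
    rw [hxy] at h1
    obtain ⟨z, hz, -⟩ := h1
    obtain ⟨y₁, hy₁, hc⟩ := ih (hz (0 : Fin 1)).2.symm (h.refl j x₁)
    have hy : E' (j + 1) y₁ y := h'.trans (h'.mono_succ hy₁) (hz (0 : Fin 1)).1
    refine ⟨y₁, hy, fun i hi => ?_⟩
    rcases Nat.lt_or_ge i (j + 1) with hi' | hi'
    · exact hc i (by omega)
    · obtain rfl : i = j + 1 := by omega
      rw [col_congr h q hx, hxy, col_congr h' q hy]

/-- The pairs in `P` match: the two sides have the same colours and the same pattern of
equivalences up to the `k`-th relation. -/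
def Match (E : ℕ → X → X → Prop) (E' : ℕ → Y → Y → Prop) (q k : ℕ) (P : List (X × Y)) : Prop :=
  (∀ p ∈ P, ∀ j ≤ k, col E q j p.1 = col E' q j p.2) ∧
    ∀ p ∈ P, ∀ p' ∈ P, ∀ j ≤ k, E j p.1 p'.1 ↔ E' j p.2 p'.2

theorem match_cons (h : Nested E) (h' : Nested E') {q k : ℕ} {P : List (X × Y)}
    (hP : Match E E' q k P) {x : X} {y : Y} (hc : ∀ j ≤ k, col E q j x = col E' q j y)
    (hE : ∀ p ∈ P, ∀ j ≤ k, E j x p.1 ↔ E' j y p.2) : Match E E' q k ((x, y) :: P) := by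
  refine ⟨?_, ?_⟩
  · intro p hp
    rcases List.mem_cons.1 hp with rfl | hp
    exacts [hc, hP.1 p hp]
  · intro p hp p' hp' j hj
    rcases List.mem_cons.1 hp with rfl | hp <;> rcases List.mem_cons.1 hp' with rfl | hp'
    · exact iff_of_true (h.refl _ _) (h'.refl _ _)
    · exact hE p' hp' j hj
    · exact ⟨fun H => h'.symm ((hE p hp j hj).1 (h.symm H)),
        fun H => h.symm ((hE p hp j hj).2 (h'.symm H))⟩
    · exact hP.2 p hp p' hp' j hj

/-- On each side of a short list of matching pairs there is room for another subclass. -/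
theorem exists_new_subclass (h : Nested E) (h' : Nested E') {q k j : ℕ} (hj : j + 1 ≤ k)
    {P : List (X × Y)} (hP : Match E E' q k P) (hq : P.length < q) {x : X} {p : X × Y} (hp : p ∈ P)
    (hx : E (j + 1) x p.1) (hnew : ∀ p' ∈ P, ¬ E j x p'.1) :
    ∃ y, E' (j + 1) y p.2 ∧ col E' q j y = col E q j x ∧ ∀ p' ∈ P, ¬ E' j y p'.2 := by
  classical
  -- `S r`: the list already meets at least `r` subclasses of the required colour inside the class
  -- of `p.1`. The maximal such `r` is below `q`, so the count `r + 1` is still visible in the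
  -- colour.
  let S : ℕ → Prop := fun r => ∃ g : Fin r → X × Y, (∀ i, g i ∈ P ∧ E (j + 1) (g i).1 p.1 ∧
    col E q j (g i).1 = col E q j x) ∧ ∀ i i', E j (g i).1 (g i').1 → i = i'
  have hle : ∀ r, S r → r ≤ P.length := by
    rintro r ⟨g, hg, hg'⟩
    have hinj : Function.Injective g := fun i i' hi => hg' i i' (hi ▸ h.refl j _)
    have : (Finset.univ.image g).card ≤ P.toFinset.card := by
      refine Finset.card_le_card fun z hz => ?_
      obtain ⟨i, -, rfl⟩ := Finset.mem_image.1 hz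
      exact List.mem_toFinset.2 (hg i).1
    rw [Finset.card_image_of_injective _ hinj, Finset.card_univ, Fintype.card_fin] at this
    exact this.trans P.toFinset_card_le
  have h0 : S 0 := ⟨Fin.elim0, fun i => i.elim0, fun i => i.elim0⟩
  obtain ⟨r, hr, hr'⟩ : ∃ r, S r ∧ ¬ S (r + 1) := by
    by_contra! hcon
    have hall : ∀ r, S r := fun r => by
      induction r with
      | zero => exact h0
      | succ r ih => exact hcon r ih
    have := hle _ (hall (P.length + 1))
    omega
  have hrq : r + 1 < q + 1 := by have := hle r hr; omega
  obtain ⟨g, hg, hg'⟩ := hr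
  have hcol : col E q (j + 1) p.1 (col E q j x) ⟨r + 1, hrq⟩ := by
    refine ⟨Fin.cons (α := fun _ => X) x fun i => (g i).1, ?_, ?_⟩
    · intro i
      refine Fin.cases ?_ (fun i => ?_) i
      · exact ⟨hx, rfl⟩
      · exact (hg i).2
    · intro i i'
      refine Fin.cases ?_ (fun i => ?_) i <;> refine Fin.cases ?_ (fun i' => ?_) i'
      · exact fun _ => rfl
      · exact fun H => (hnew _ (hg i').1 H).elim
      · exact fun H => (hnew _ (hg i).1 (h.symm H)).elim
      · exact fun H => congrArg Fin.succ (hg' i i' H)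
  rw [hP.1 p hp _ hj] at hcol
  obtain ⟨y, hy, hy'⟩ := hcol
  -- If the list met all `r + 1` subclasses found on the right, the corresponding left entries would
  -- give `S (r + 1)`.
  by_contra! hcon
  choose g' hg₁ hg₂ using fun i => hcon (y i) (hy i).1 (hy i).2
  refine hr' ⟨g', fun i => ⟨hg₁ i, ?_, ?_⟩, fun i i' hi => ?_⟩
  · exact (hP.2 _ (hg₁ i) _ hp _ hj).2 (h'.trans (h'.symm (h'.mono_succ (hg₂ i))) (hy i).1)
  · rw [hP.1 _ (hg₁ i) _ (by omega), ← (hy i).2]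
    exact col_congr h' q (h'.symm (hg₂ i))
  · have := (hP.2 _ (hg₁ i) _ (hg₁ i') _ (by omega)).1 hi
    exact hy' i i' (h'.trans (hg₂ i) (h'.trans this (h'.symm (hg₂ i'))))

/-- The back-and-forth step, in structures that form a single class of the `k`-th relation. -/
theorem exists_match_cons (h : Nested E) (h' : Nested E') {q k : ℕ}
    (htop : ∀ x x', E k x x')
    (hcol : ∀ x y, col E q k x = col E' q k y) [Nonempty Y] {P : List (X × Y)}
    (hP : Match E E' q k P) (hq : P.length < q) (x : X) :
    ∃ y, Match E E' q k ((x, y) :: P) := by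
  classical
  rcases P.eq_nil_or_concat with rfl | hne
  · obtain ⟨y, -, hy⟩ := exists_col_eq h h' (by simp at hq; omega) (hcol x (Classical.arbitrary Y))
      (h.refl k x)
    exact ⟨y, match_cons h h' hP hy (by simp)⟩
  obtain ⟨p₀, hp₀⟩ : ∃ p₀, p₀ ∈ P := by obtain ⟨l, a, rfl⟩ := hne; exact ⟨a, by simp⟩
  -- The answer is governed by the least level at which `x` is equivalent to an element of the list:
  -- below it `y` must avoid the list, above it `y` inherits everything from `p.2`.
  have hex : ∃ j, ∃ p ∈ P, E j x p.1 := ⟨k, p₀, hp₀, htop _ _⟩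
  obtain ⟨p, hp, hxp⟩ := Nat.find_spec hex
  have hmin : ∀ i < Nat.find hex, ∀ p' ∈ P, ¬ E i x p'.1 := fun i hi p' hp' H =>
    Nat.find_min hex hi ⟨p', hp', H⟩
  have hk : Nat.find hex ≤ k := Nat.find_min' hex ⟨p₀, hp₀, htop _ _⟩
  generalize Nat.find hex = j at hxp hmin hk
  cases j with
  | zero =>
    obtain rfl := h.eq_of_zero hxp
    exact ⟨p.2, match_cons h h' hP (hP.1 p hp) fun p' hp' => hP.2 p hp p' hp'⟩
  | succ j =>
    obtain ⟨y, hy, hyc, hynew⟩ := exists_new_subclass h h' hk hP hq hp hxp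
      (hmin j (by omega))
    -- The class of `y` has the right colour only at level `j`; moving inside that class corrects
    -- the colours at all lower levels.
    obtain ⟨y₁, hy₁, hc⟩ := exists_col_eq h h' (by omega) hyc.symm (h.refl j x)
    have hy₁p : E' (j + 1) y₁ p.2 := h'.trans (h'.mono_succ hy₁) hy
    refine ⟨y₁, match_cons h h' hP (fun i hi => ?_) fun p' hp' i hi => ?_⟩
    · rcases Nat.lt_or_ge j i with hi' | hi'
      · rw [col_congr h q (h.mono (Nat.succ_le_of_lt hi') hxp), hP.1 p hp i hi,
          col_congr h' q (h'.mono (Nat.succ_le_of_lt hi') hy₁p)]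
      · exact hc i hi'
    · rcases Nat.lt_or_ge j i with hi' | hi'
      · rw [h.congr_left (h.mono (Nat.succ_le_of_lt hi') hxp), hP.2 p hp p' hp' i hi,
          h'.congr_left (h'.mono (Nat.succ_le_of_lt hi') hy₁p)]
      · refine iff_of_false (hmin i (by omega) p' hp') fun H => hynew p' hp' ?_
        exact h'.trans (h'.symm hy₁) (h'.mono hi' H)

end

-- Truncation, and realization of every colour in a finite component

/-- The relations up to the `k`-th one, followed by relations that hold everywhere. -/
def trunc {X : Type} (E : ℕ → X → X → Prop) (k j : ℕ) (x y : X) : Prop :=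
  j ≤ k → E j x y

section

variable {X : Type} {E : ℕ → X → X → Prop}

theorem nested_trunc (h : Nested E) (k : ℕ) : Nested (trunc E k) where
  equiv j := ⟨fun _ _ => h.refl _ _, fun H hj => h.symm (H hj),
    fun H H' hj => h.trans (H hj) (H' hj)⟩
  mono_succ H hj := h.mono_succ (H (by omega))
  eq_of_zero H := h.eq_of_zero (H (Nat.zero_le k))

theorem trunc_of_le {j k : ℕ} (hj : j ≤ k) (x y : X) : trunc E k j x y ↔ E j x y :=
  ⟨fun H => H hj, fun H _ => H⟩

theorem trunc_succ (k : ℕ) (x y : X) : trunc E k (k + 1) x y := fun H => by omega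

theorem col_trunc (h : Nested E) (q k : ℕ) {j : ℕ} (hj : j ≤ k) (x : X) :
    col (trunc E k) q j x = col E q j x :=
  col_map (nested_trunc h k) q k id (fun _ hj _ _ => trunc_of_le hj _ _)
    (fun _ y _ => ⟨y, rfl⟩) j hj x

end

/-- The disjoint union of all finite sets of finitely supported sequences, each taken infinitely
often. -/
abbrev Point : Type := Σ c : Finset (ℕ →₀ ℕ) × ℕ, {f // f ∈ c.1}

/-- A point as a sequence with a key that determines the component. -/
def Point.keyed (c : Point) : (Finset (ℕ →₀ ℕ) × ℕ) × (ℕ → ℕ) := (c.1, c.2.1)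

theorem Point.keyed_injective : Function.Injective Point.keyed := by
  rintro ⟨c, f, hf⟩ ⟨c', f', hf'⟩ h
  obtain rfl : c = c' := congrArg Prod.fst h
  obtain rfl : f = f' := DFunLike.coe_injective (congrArg Prod.snd h)
  rfl

/-- The relations on the points: agreement from an index on, within a component. -/
def PointE (j : ℕ) (c c' : Point) : Prop := TailEq j c.keyed c'.keyed

theorem nested_pointE : Nested PointE := (nested_tailEq _ _).comap Point.keyed_injective

/-- The colour of a point does not depend on the copy of its component. -/
theorem col_pointE_copy (q k : ℕ) (F : Finset (ℕ →₀ ℕ)) (m m' : ℕ) (f : {f // f ∈ F}) :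
    col PointE q k ⟨(F, m), f⟩ = col PointE q k ⟨(F, m'), f⟩ := by
  have key : ∀ m, col PointE q k ⟨(F, m), f⟩ =
      col (fun j (f g : {f // f ∈ F}) => TailEq j ((), ⇑f.1) ((), ⇑g.1)) q k f := by
    intro m
    refine col_map nested_pointE q k (fun f : {f // f ∈ F} => (⟨(F, m), f⟩ : Point)) ?_ ?_ k le_rfl f
    · intro j _ f f'
      exact and_congr (iff_of_true rfl rfl) Iff.rfl
    · rintro f ⟨c, g⟩ H
      obtain rfl : c = (F, m) := H.1
      exact ⟨g, rfl⟩
  rw [key m, key m']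

/-- A finite nested structure with a single class embeds into the points, as a component. -/
theorem exists_point_of_finite {Z : Type} [Finite Z] {E : ℕ → Z → Z → Prop} (h : Nested E)
    (q k : ℕ) (htop : ∀ z z', E k z z') (z : Z) : ∃ c, col PointE q k c = col E q k z := by
  classical
  have := Fintype.ofFinite Z
  obtain ⟨ι, hι⟩ := exists_injective_nat Z
  let s : ∀ j, Setoid Z := fun j => ⟨E j, h.equiv j⟩
  let r : ℕ → Z → Z := fun j z => (Quotient.mk (s j) z).out
  have hr : ∀ j z z', r j z = r j z' ↔ E j z z' := fun j z z' =>
    (Quotient.out_inj (s := s j)).trans Quotient.eq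
  -- Entry `i < k` codes the `E i`-class. Since the relations are nested, agreement from `j` on is
  -- the same as `E j`; for `j = k` both hold everywhere.
  let e : Z → ℕ →₀ ℕ := fun z => Finsupp.onFinset (Finset.range k)
    (fun i => if i < k then ι (r i z) else 0) fun i hi => by
      by_contra hik
      rw [Finset.mem_range] at hik
      simp [hik] at hi
  let F : Finset (ℕ →₀ ℕ) := Finset.univ.image e
  let e' : Z → Point := fun z => ⟨(F, 0), e z, Finset.mem_image_of_mem e (Finset.mem_univ z)⟩
  refine ⟨e' z, col_map nested_pointE q k e' ?_ ?_ k le_rfl z⟩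
  · intro j hj z z'
    constructor
    · rintro ⟨-, H⟩
      rcases Nat.lt_or_ge j k with hjk | hjk
      · have H' : (if j < k then ι (r j z) else 0) = if j < k then ι (r j z') else 0 := H j le_rfl
        rw [if_pos hjk, if_pos hjk] at H'
        exact (hr _ _ _).1 (hι H')
      · obtain rfl : j = k := le_antisymm hj hjk
        exact htop _ _
    · refine fun H => ⟨rfl, fun i hi => ?_⟩
      change (if i < k then ι (r i z) else 0) = if i < k then ι (r i z') else 0
      rw [(hr i z z').2 (h.mono hi H)]
  · rintro z ⟨c, g, hg⟩ ⟨H, -⟩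
    obtain rfl : c = (F, 0) := H
    obtain ⟨z', -, rfl⟩ := Finset.mem_image.1 hg
    exact ⟨z', rfl⟩

/-- Every colour is the colour of a finite subset. -/
theorem exists_finite_subset {X : Type} {E : ℕ → X → X → Prop} (h : Nested E) (q k : ℕ) (x : X) :
    ∃ F : Set X, F.Finite ∧ F.Nonempty ∧ (∀ z ∈ F, E k z x) ∧
      ∀ z : F, col (fun j (z z' : F) => E j z z') q k z = col E q k x := by
  classical
  induction k generalizing x with
  | zero =>
    exact ⟨{x}, Set.finite_singleton x, Set.singleton_nonempty x,
      fun z hz => hz ▸ h.refl _ _, fun _ => rfl⟩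
  | succ k ih =>
    choose F hF hFn hFE hFc using ih
    have : Nonempty X := ⟨x⟩
    have hw : ∀ (γ : Color q k) (m : Fin (q + 1)), ∃ y : Fin m → X, col E q (k + 1) x γ m →
        (∀ i, E (k + 1) (y i) x ∧ col E q k (y i) = γ) ∧ ∀ i i', E k (y i) (y i') → i = i' := by
      intro γ m
      by_cases H : col E q (k + 1) x γ m
      · obtain ⟨y, hy⟩ := H
        exact ⟨y, fun _ => hy⟩
      · exact ⟨fun _ => x, fun H' => (H H').elim⟩
    choose w hw using hw
    let s : Setoid X := ⟨E k, h.equiv k⟩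
    let r : X → X := fun z => (Quotient.mk s z).out
    have hr : ∀ z, E k (r z) z := fun z => Quotient.mk_out (s := s) z
    have hr' : ∀ z z', E k z z' → r z = r z' := fun z z' H => by
      have : Quotient.mk s z = Quotient.mk s z' := Quotient.sound H
      simp only [r, this]
    -- One representative for each `E k`-class that a witness needs. The element `x` is included so
    -- that the set is nonempty, and the condition `E (k + 1) z x` discards the arbitrary values of
    -- `w` at counts that do not occur.
    let Y : Set X := r '' {z | E (k + 1) z x ∧ (z = x ∨ ∃ γ m i, w γ m i = z)}
    have hYfin : Y.Finite := by
      refine Set.Finite.image r (Set.Finite.subset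
        (s := {x} ∪ Set.range fun t : Σ (γ : Color q k) (m : Fin (q + 1)), Fin m =>
          w t.1 t.2.1 t.2.2) ?_ ?_)
      · exact (Set.finite_singleton x).union (Set.finite_range _)
      · rintro z ⟨-, rfl | ⟨γ, m, i, rfl⟩⟩
        · exact Or.inl rfl
        · exact Or.inr ⟨⟨γ, m, i⟩, rfl⟩
    have hYx : ∀ y ∈ Y, E (k + 1) y x := by
      rintro _ ⟨z, ⟨hz, -⟩, rfl⟩
      exact h.trans (h.mono_succ (hr z)) hz
    have hYr : ∀ y ∈ Y, ∀ y' ∈ Y, E k y y' → y = y' := by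
      rintro _ ⟨z, -, rfl⟩ _ ⟨z', -, rfl⟩ H
      exact hr' _ _ (h.trans (h.symm (hr z)) (h.trans H (hr z')))
    let G : Set X := {z | ∃ y ∈ Y, z ∈ F y}
    have hGx : ∀ z ∈ G, E (k + 1) z x := by
      rintro z ⟨y, hy, hz⟩
      exact h.trans (h.mono_succ (hFE y z hz)) (hYx y hy)
    have hG : Nested fun j (z z' : G) => E j z z' := h.comap Subtype.val_injective
    have hGc : ∀ y ∈ Y, ∀ z (hz : z ∈ F y) (hzG : z ∈ G),
        col (fun j (z z' : G) => E j z z') q k ⟨z, hzG⟩ = col E q k y := by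
      intro y hy z hz hzG
      refine Eq.trans ?_ (hFc y ⟨z, hz⟩)
      -- Distinct representatives are `E k`-inequivalent, so `F y` is a whole `E k`-class of `G` and
      -- keeps its colour.
      refine col_map hG q k (fun z : F y => (⟨z, y, hy, z.2⟩ : G))
        (fun _ _ _ _ => Iff.rfl) ?_ k le_rfl ⟨z, hz⟩
      rintro ⟨u, hu⟩ ⟨u', y', hy', hu'⟩ H
      obtain rfl : y' = y := hYr _ hy' _ hy
        (h.trans (h.symm (hFE _ _ hu')) (h.trans H (hFE _ _ hu)))
      exact ⟨⟨u', hu'⟩, rfl⟩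
    refine ⟨G, ?_, ?_, hGx, ?_⟩
    · exact (hYfin.biUnion fun y _ => hF y).subset fun z ⟨y, hy, hz⟩ =>
        Set.mem_biUnion hy hz
    · obtain ⟨z, hz⟩ := hFn (r x)
      exact ⟨z, r x, ⟨x, ⟨h.refl _ _, Or.inl rfl⟩, rfl⟩, hz⟩
    · intro z
      funext γ m
      refine propext ?_
      constructor
      · rintro ⟨u, hu, hu'⟩
        choose y hy hyu using fun i => (u i).2
        refine ⟨y, fun i => ⟨hYx _ (hy i), ?_⟩, fun i i' H => hu' i i' ?_⟩
        · rw [← (hu i).2, ← hGc (y i) (hy i) (u i) (hyu i) (u i).2]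
        · obtain H' := hYr _ (hy i) _ (hy i') H
          exact h.trans (hFE _ _ (hyu i)) (h.symm (H' ▸ hFE _ _ (hyu i')))
      · intro H
        obtain ⟨hw₁, hw₂⟩ := hw γ m H
        choose u hu using fun i => hFn (r (w γ m i))
        have hY : ∀ i, r (w γ m i) ∈ Y := fun i => ⟨_, ⟨(hw₁ i).1, Or.inr ⟨γ, m, i, rfl⟩⟩, rfl⟩
        have huw : ∀ i, E k (u i) (w γ m i) := fun i => h.trans (hFE _ _ (hu i)) (hr _)
        have huG : ∀ i, u i ∈ G := fun i => ⟨_, hY i, hu i⟩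
        refine ⟨fun i => ⟨u i, huG i⟩, fun i => ⟨?_, ?_⟩, fun i i' H => hw₂ i i' ?_⟩
        · exact h.trans (hGx _ (huG i)) (h.symm (hGx _ z.2))
        · rw [hGc _ (hY i) (u i) (hu i), col_congr h q (hr _)]
          exact (hw₁ i).2
        · exact h.trans (h.symm (huw i)) (h.trans H (huw i'))

/-- Every colour is the colour of a point. -/
theorem exists_point_col {X : Type} {E : ℕ → X → X → Prop} (h : Nested E) (q k : ℕ) (x : X) :
    ∃ c, col PointE q k c = col E q k x := by
  obtain ⟨F, hF, ⟨z, hz⟩, hFE, hFc⟩ := exists_finite_subset h q k x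
  have := hF.to_subtype
  obtain ⟨c, hc⟩ := exists_point_of_finite
    (E := fun j (z z' : F) => E j z z') (h.comap Subtype.val_injective) q k
    (fun z z' => h.trans (hFE z z.2) (h.symm (hFE z' z'.2))) ⟨z, hz⟩
  exact ⟨c, hc.trans (hFc _)⟩

-- The language, good structures and the universal theory

open FirstOrder.Language BoundedFormula

/-- The function symbols: a constant for each point. -/
inductive Func : ℕ → Type
  | const : Point → Func 0

/-- The relation symbols: a sequence of binary relations. -/
inductive Rel : ℕ → Type
  | equiv : ℕ → Rel 2

/-- The language with a constant for each point and a sequence of binary relations. -/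
def Lang : FirstOrder.Language.{0, 0} := ⟨Func, Rel⟩

theorem card_lang : Lang.card ≤ ℵ₀ := by
  have h₁ : Countable (Σ n, Lang.Functions n) := by
    refine Function.Surjective.countable
      (f := fun c : Point => (⟨0, Func.const c⟩ : Σ n, Lang.Functions n)) ?_
    rintro ⟨_, ⟨c⟩⟩
    exact ⟨c, rfl⟩
  have h₂ : Countable (Σ n, Lang.Relations n) := by
    refine Function.Surjective.countable
      (f := fun j : ℕ => (⟨2, Rel.equiv j⟩ : Σ n, Lang.Relations n)) ?_
    rintro ⟨_, ⟨j⟩⟩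
    exact ⟨j, rfl⟩
  exact Cardinal.mk_le_aleph0 (α := (Σ n, Lang.Functions n) ⊕ (Σ n, Lang.Relations n))

/-- The constant symbol of a point. -/
def cSym (c : Point) : Lang.Constants := Func.const c

/-- The symbol of the `j`-th relation. -/
def rSym (j : ℕ) : Lang.Relations 2 := Rel.equiv j

section

variable (M : Type) [Lang.Structure M]

/-- The interpretation of the constant of a point. -/
def cst (c : Point) : M := (cSym c : M)

variable {M}

/-- The interpretation of the `j`-th relation. -/
def rel (j : ℕ) (x y : M) : Prop := Structure.RelMap (rSym j) ![x, y]

variable (M)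

/-- Structures with nested equivalence relations in which the points form a substructure whose
components are closed in the whole structure. -/
structure Good : Prop where
  nested : Nested (rel (M := M))
  rel_cst : ∀ j c c', rel j (cst M c) (cst M c') ↔ PointE j c c'
  closed : ∀ j c x, rel j x (cst M c) → ∃ c', x = cst M c'

end

/-- The `∀₁`-sentences true in all good structures. -/
def goodTheory : Lang.Theory :=
  {φ | IsForallLevel 1 0 φ ∧ ∀ (M : Type) [Lang.Structure M], Good M → M ⊨ φ}

theorem Good.model {M : Type} [Lang.Structure M] (h : Good M) : M ⊨ goodTheory :=
  (Theory.model_iff _).2 fun _ hφ => hφ.2 M h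

theorem isForallAxiomatizable_goodTheory : goodTheory.IsForallAxiomatizable 1 :=
  ⟨goodTheory, fun _ hφ => hφ.1, fun _ hφ => Theory.models_sentence_of_mem hφ,
    fun _ hφ => Theory.models_sentence_of_mem hφ⟩

/-- The atomic formula of the `j`-th relation. -/
def relF {α : Type} {n : ℕ} (j : ℕ) (s t : Lang.Term (α ⊕ Fin n)) : Lang.BoundedFormula α n :=
  (rSym j).boundedFormula₂ s t

theorem isQF_relF {α : Type} {n : ℕ} (j : ℕ) (s t : Lang.Term (α ⊕ Fin n)) : (relF j s t).IsQF :=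
  (IsAtomic.rel _ _).isQF

theorem isQF_foldr_sup {L : FirstOrder.Language} {α : Type*} {n : ℕ} (l : List (L.BoundedFormula α n))
    (h : ∀ φ ∈ l, φ.IsQF) : (l.foldr (· ⊔ ·) ⊥).IsQF := by
  induction l with
  | nil => exact isQF_bot
  | cons φ l ih =>
    exact (h φ (by simp)).sup (ih fun ψ hψ => h ψ (by simp [hψ]))

@[simp]
theorem realize_relF {M : Type} [Lang.Structure M] {α : Type} {n : ℕ} (j : ℕ)
    (s t : Lang.Term (α ⊕ Fin n)) (v : α → M) (xs : Fin n → M) :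
    (relF j s t).Realize v xs ↔
      rel j (s.realize (Sum.elim v xs)) (t.realize (Sum.elim v xs)) :=
  realize_rel₂

@[simp]
theorem coe_cSym {M : Type} [Lang.Structure M] (c : Point) : (cSym c : M) = cst M c := rfl

theorem realize_of_forall {M : Type} [Lang.Structure M] (hM : M ⊨ goodTheory) {φ : Lang.Sentence}
    (hφ : IsForallLevel 1 0 φ) (h : ∀ (N : Type) [Lang.Structure N], Good N → N ⊨ φ) : M ⊨ φ :=
  (Theory.model_iff _).1 hM φ ⟨hφ, h⟩

theorem isForallLevel_all {L : FirstOrder.Language} {l : ℕ} {φ : L.BoundedFormula Empty (l + 1)}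
    (h : IsForallLevel 1 (l + 1) φ) : IsForallLevel 1 l φ.all := by
  unfold IsForallLevel at *
  exact .all h

theorem isForallLevel_of_isQF {L : FirstOrder.Language} {l : ℕ} {φ : L.BoundedFormula Empty l}
    (h : φ.IsQF) : IsForallLevel 1 l φ := by
  unfold IsForallLevel IsExistsLevel
  exact .base h

/-- Each clause of `Good` amounts to universal sentences. For `closed`, the key of a constant
determines a finite component, so the existential quantifier over constants becomes a finite
disjunction. -/
theorem good_of_model {M : Type} [Lang.Structure M] (hM : M ⊨ goodTheory) : Good M where
  nested :=
    { equiv := by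
        intro j
        refine ⟨?_, ?_, ?_⟩
        · have := realize_of_forall hM (φ := (relF j (&0) (&0)).all)
            (isForallLevel_all (isForallLevel_of_isQF (isQF_relF _ _ _)))
            (fun N _ h => by
              simpa [Sentence.Realize, Formula.Realize, Fin.snoc] using h.nested.refl j)
          simpa [Sentence.Realize, Formula.Realize, Fin.snoc] using this
        · have := realize_of_forall hM
            (φ := ((relF j (&0) (&1)).imp (relF j (&1) (&0))).all.all)
            (isForallLevel_all (isForallLevel_all (isForallLevel_of_isQF
              ((isQF_relF _ _ _).imp (isQF_relF _ _ _)))))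
            (fun N _ h => by
              simpa [Sentence.Realize, Formula.Realize, Fin.snoc] using
                fun x y => h.nested.symm (j := j) (x := x) (y := y))
          simpa [Sentence.Realize, Formula.Realize, Fin.snoc] using this
        · have := realize_of_forall hM
            (φ := ((relF j (&0) (&1)).imp ((relF j (&1) (&2)).imp (relF j (&0) (&2)))).all.all.all)
            (isForallLevel_all (isForallLevel_all (isForallLevel_all (isForallLevel_of_isQF
              ((isQF_relF _ _ _).imp ((isQF_relF _ _ _).imp (isQF_relF _ _ _)))))))
            (fun N _ h => by
              simpa [Sentence.Realize, Formula.Realize, Fin.snoc] using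
                fun x y z => h.nested.trans (j := j) (x := x) (y := y) (z := z))
          simpa [Sentence.Realize, Formula.Realize, Fin.snoc] using this
      mono_succ := by
        intro j
        have := realize_of_forall hM
          (φ := ((relF j (&0) (&1)).imp (relF (j + 1) (&0) (&1))).all.all)
          (isForallLevel_all (isForallLevel_all (isForallLevel_of_isQF
            ((isQF_relF _ _ _).imp (isQF_relF _ _ _)))))
          (fun N _ h => by
            simpa [Sentence.Realize, Formula.Realize, Fin.snoc] using
              fun x y => h.nested.mono_succ (j := j) (x := x) (y := y))
        simpa [Sentence.Realize, Formula.Realize, Fin.snoc] using this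
      eq_of_zero := by
        have := realize_of_forall hM
          (φ := ((relF 0 (&0) (&1)).imp ((&0).bdEqual (&1))).all.all)
          (isForallLevel_all (isForallLevel_all (isForallLevel_of_isQF
            ((isQF_relF _ _ _).imp (IsAtomic.equal _ _).isQF))))
          (fun N _ h => by
            simpa [Sentence.Realize, Formula.Realize, Fin.snoc] using
              fun x y => h.nested.eq_of_zero (x := x) (y := y))
        simpa [Sentence.Realize, Formula.Realize, Fin.snoc] using this }
  rel_cst j c c' := by
    by_cases hc : PointE j c c'
    · have := realize_of_forall hM (φ := relF j (cSym c).term (cSym c').term)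
        (isForallLevel_of_isQF (isQF_relF _ _ _))
        (fun N _ h => by
          simpa [Sentence.Realize, Formula.Realize, hc] using h.rel_cst j c c')
      simpa [Sentence.Realize, Formula.Realize, hc] using this
    · have := realize_of_forall hM (φ := (relF j (cSym c).term (cSym c').term).not)
        (isForallLevel_of_isQF (isQF_relF _ _ _).not)
        (fun N _ h => by
          simpa [Sentence.Realize, Formula.Realize, hc] using h.rel_cst j c c')
      simpa [Sentence.Realize, Formula.Realize, hc] using this
  closed j c := by
    obtain ⟨k, f⟩ := c
    have := realize_of_forall hM
      (φ := ((relF j (&0) (cSym ⟨k, f⟩).term).imp ((k.1.attach.toList.map fun g =>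
        (&0).bdEqual (cSym ⟨k, g⟩).term).foldr (· ⊔ ·) ⊥)).all)
      (isForallLevel_all (isForallLevel_of_isQF ((isQF_relF _ _ _).imp (isQF_foldr_sup _
        fun φ hφ => by
          obtain ⟨g, -, rfl⟩ := List.mem_map.1 hφ
          exact (IsAtomic.equal _ _).isQF))))
      (fun N _ h => by
        simp only [Sentence.Realize, Formula.Realize, realize_all, realize_imp, realize_relF,
          realize_foldr_sup, List.mem_map]
        intro x hx
        obtain ⟨⟨k', g⟩, rfl⟩ : ∃ c', x = cst N c' := h.closed j ⟨k, f⟩ x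
          (by simpa [Fin.snoc] using hx)
        have hk : k' = k := ((h.rel_cst j ⟨k', g⟩ ⟨k, f⟩).1 (by simpa [Fin.snoc] using hx)).1
        subst hk
        exact ⟨_, ⟨g, by simp, rfl⟩, by simp [Fin.snoc]⟩)
    intro x hx
    simp only [Sentence.Realize, Formula.Realize, realize_all, realize_imp, realize_relF,
      realize_foldr_sup, List.mem_map] at this
    obtain ⟨φ, ⟨g, -, rfl⟩, hg⟩ := this x (by simpa [Fin.snoc] using hx)
    exact ⟨⟨k, g⟩, by simpa [Fin.snoc] using hg⟩

-- Elimination of formulas in favour of colours and equivalences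

section

variable {M N : Type} [Lang.Structure M] [Lang.Structure N]

theorem Good.col_cst (h : Good M) (q k : ℕ) (c : Point) :
    col (rel (M := M)) q k (cst M c) = col PointE q k c := by
  refine col_map h.nested q k (cst M) (fun j _ c c' => h.rel_cst j c c') (fun c y H => ?_) k le_rfl c
  obtain ⟨c', rfl⟩ := h.closed k c y H
  exact ⟨c', rfl⟩

/-- In a good structure, every colour that occurs at all occurs infinitely often. -/
theorem Good.col_trunc_succ_iff (h : Good M) (q k : ℕ) (x : M) (γ : Color q k) (m : Fin (q + 1)) :
    col (trunc (rel (M := M)) k) q (k + 1) x γ m ↔ (m : ℕ) = 0 ∨ ∃ c, col PointE q k c = γ := by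
  rw [col_succ]
  constructor
  · rintro ⟨y, hy, -⟩
    rcases Nat.eq_zero_or_pos m with hm | hm
    · exact Or.inl hm
    · right
      rw [← (hy ⟨0, hm⟩).2, col_trunc h.nested q k le_rfl]
      exact exists_point_col h.nested q k _
  · rintro (hm | ⟨⟨⟨F, i⟩, f⟩, rfl⟩)
    · have : IsEmpty (Fin (m : ℕ)) := by rw [hm]; infer_instance
      exact ⟨fun i => isEmptyElim i, fun i => isEmptyElim i, fun i => isEmptyElim i⟩
    -- The copies of one component have different keys, so their points are inequivalent at every
    -- level and share a colour.
    · refine ⟨fun i => cst M ⟨(F, i), f⟩, fun i' => ⟨trunc_succ k _ _, ?_⟩, fun i i' H => ?_⟩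
      · rw [col_trunc h.nested q k le_rfl, h.col_cst]
        exact col_pointE_copy q k F _ _ f
      · have := (h.rel_cst _ _ _).1 ((trunc_of_le le_rfl _ _).1 H)
        exact Fin.ext (congrArg Prod.snd this.1)

/-- The total relation placed at level `k + 1` adds no information, since its colour is the same in
all good structures. This reduces good structures to the single-class situation. -/
theorem Good.match_trunc_iff (h : Good M) (h' : Good N) (q k : ℕ) (P : List (M × N)) :
    Match (trunc (rel (M := M)) k) (trunc (rel (M := N)) k) q (k + 1) P ↔
      Match (rel (M := M)) (rel (M := N)) q k P := by
  constructor
  · rintro ⟨h₁, h₂⟩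
    refine ⟨fun p hp j hj => ?_, fun p hp p' hp' j hj => ?_⟩
    · rw [← col_trunc h.nested q k hj, h₁ p hp j (by omega), col_trunc h'.nested q k hj]
    · exact (trunc_of_le hj _ _).symm.trans
        ((h₂ p hp p' hp' j (by omega)).trans (trunc_of_le hj _ _))
  · rintro ⟨h₁, h₂⟩
    refine ⟨fun p hp j hj => ?_, fun p hp p' hp' j hj => ?_⟩ <;>
      rcases Nat.lt_or_ge k j with hj' | hj'
    · obtain rfl : j = k + 1 := by omega
      funext γ m
      exact propext ((h.col_trunc_succ_iff q k _ γ m).trans (h'.col_trunc_succ_iff q k _ γ m).symm)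
    · rw [col_trunc h.nested q k hj', col_trunc h'.nested q k hj', h₁ p hp j hj']
    · obtain rfl : j = k + 1 := by omega
      exact iff_of_true (trunc_succ k _ _) (trunc_succ k _ _)
    · rw [trunc_of_le hj', trunc_of_le hj', h₂ p hp p' hp' j hj']

theorem Good.exists_match_cons (h : Good M) (h' : Good N) {q k : ℕ} {P : List (M × N)}
    (hP : Match (rel (M := M)) (rel (M := N)) q k P) (hq : P.length < q) (x : M) :
    ∃ y, Match (rel (M := M)) (rel (M := N)) q k ((x, y) :: P) := by
  have : Nonempty N := ⟨cst N ⟨({0}, 0), 0, by simp⟩⟩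
  simp only [← h.match_trunc_iff h'] at hP ⊢
  refine NestedEquiv.exists_match_cons (nested_trunc h.nested k) (nested_trunc h'.nested k)
    (trunc_succ k) (fun x y => ?_) hP hq x
  funext γ m
  exact propext ((h.col_trunc_succ_iff q k _ γ m).trans (h'.col_trunc_succ_iff q k _ γ m).symm)

theorem match_swap {X Y : Type} {E : ℕ → X → X → Prop} {E' : ℕ → Y → Y → Prop} {q k : ℕ}
    {P : List (X × Y)} (hP : Match E E' q k P) : Match E' E q k (P.map Prod.swap) := by
  constructor
  · intro p hp j hj
    obtain ⟨p, hpP, rfl⟩ := List.mem_map.1 hp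
    exact (hP.1 p hpP j hj).symm
  · intro p hp p' hp' j hj
    obtain ⟨p, hpP, rfl⟩ := List.mem_map.1 hp
    obtain ⟨p', hpP', rfl⟩ := List.mem_map.1 hp'
    exact (hP.2 p hpP p' hpP' j hj).symm

theorem Good.exists_match_cons' (h : Good M) (h' : Good N) {q k : ℕ} {P : List (M × N)}
    (hP : Match (rel (M := M)) (rel (M := N)) q k P) (hq : P.length < q) (y : N) :
    ∃ x, Match (rel (M := M)) (rel (M := N)) q k ((x, y) :: P) := by
  obtain ⟨x, hx⟩ := h'.exists_match_cons h (match_swap hP) (by simpa using hq) y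
  refine ⟨x, ?_⟩
  have := match_swap hx
  simpa [Function.comp_def] using this

end

theorem match_mono {X Y : Type} {E : ℕ → X → X → Prop} {E' : ℕ → Y → Y → Prop} {q k k' : ℕ}
    (hk : k ≤ k') {P : List (X × Y)} (hP : Match E E' q k' P) : Match E E' q k P :=
  ⟨fun p hp j hj => hP.1 p hp j (hj.trans hk), fun p hp p' hp' j hj =>
    hP.2 p hp p' hp' j (hj.trans hk)⟩

/-- The values of a term at tuples in two structures are among the given pairs, provided that these
include finitely many pairs determined by the term. -/
theorem exists_lists_of_term {α : Type} {n : ℕ} (t : Lang.Term (α ⊕ Fin n)) :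
    ∃ (G : List α) (C : List Point), ∀ (M N : Type) [Lang.Structure M] [Lang.Structure N]
      (P : List (M × N)) (v : α → M) (w : α → N) (xs : Fin n → M) (ys : Fin n → N),
      (∀ a ∈ G, (v a, w a) ∈ P) → (∀ c ∈ C, (cst M c, cst N c) ∈ P) → (∀ i, (xs i, ys i) ∈ P) →
      (t.realize (Sum.elim v xs), t.realize (Sum.elim w ys)) ∈ P := by
  cases t with
  | var i =>
    rcases i with a | i
    · exact ⟨[a], [], fun M N _ _ P v w xs ys hG _ _ => hG a (by simp)⟩
    · exact ⟨[], [], fun M N _ _ P v w xs ys _ _ hxy => hxy i⟩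
  | func f ts =>
    obtain ⟨c⟩ := f
    refine ⟨[], [c], fun M N _ _ P v w xs ys _ hC _ => ?_⟩
    have key : ∀ (K : Type) [Lang.Structure K] (u : α ⊕ Fin n → K),
        (Term.func (L := Lang) (Func.const c) ts).realize u = cst K c := by
      intro K _ u
      exact congrArg (Structure.funMap (L := Lang) (Func.const c)) (Subsingleton.elim _ _)
    rw [key, key]
    exact hC c (by simp)

/-- A formula only depends on the colours, up to a finite level, and on the equivalences. -/
theorem exists_realize_iff_of_match {α : Type} {n : ℕ} (φ : Lang.BoundedFormula α n) :
    ∃ (k d : ℕ) (G : List α) (C : List Point), ∀ (M N : Type) [Lang.Structure M] [Lang.Structure N],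
      Good M → Good N → ∀ (q : ℕ) (P : List (M × N)) (v : α → M) (w : α → N) (xs : Fin n → M)
      (ys : Fin n → N), Match (rel (M := M)) (rel (M := N)) q k P → P.length + d ≤ q →
      (∀ a ∈ G, (v a, w a) ∈ P) → (∀ c ∈ C, (cst M c, cst N c) ∈ P) → (∀ i, (xs i, ys i) ∈ P) →
      (φ.Realize v xs ↔ φ.Realize w ys) := by
  induction φ with
  | falsum => exact ⟨0, 0, [], [], fun _ _ _ _ _ _ _ _ _ _ _ _ _ _ _ _ _ => Iff.rfl⟩
  | equal s t =>
    obtain ⟨G₁, C₁, h₁⟩ := exists_lists_of_term s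
    obtain ⟨G₂, C₂, h₂⟩ := exists_lists_of_term t
    refine ⟨0, 0, G₁ ++ G₂, C₁ ++ C₂, fun M N _ _ hM hN q P v w xs ys hP _ hG hC hxy => ?_⟩
    have hs := h₁ M N P v w xs ys (fun a ha => hG a (by simp [ha])) (fun c hc => hC c (by simp [hc]))
      hxy
    have ht := h₂ M N P v w xs ys (fun a ha => hG a (by simp [ha])) (fun c hc => hC c (by simp [hc]))
      hxy
    have key : ∀ {K : Type} [Lang.Structure K], Good K → ∀ x y : K, x = y ↔ rel 0 x y :=
      fun h x y => ⟨fun H => H ▸ h.nested.refl 0 x, h.nested.eq_of_zero⟩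
    simp only [BoundedFormula.Realize]
    rw [key hM, key hN]
    exact hP.2 _ hs _ ht 0 le_rfl
  | rel R ts =>
    obtain ⟨j⟩ := R
    obtain ⟨G₁, C₁, h₁⟩ := exists_lists_of_term (ts 0)
    obtain ⟨G₂, C₂, h₂⟩ := exists_lists_of_term (ts 1)
    refine ⟨j, 0, G₁ ++ G₂, C₁ ++ C₂, fun M N _ _ hM hN q P v w xs ys hP _ hG hC hxy => ?_⟩
    have hs := h₁ M N P v w xs ys (fun a ha => hG a (by simp [ha])) (fun c hc => hC c (by simp [hc]))
      hxy
    have ht := h₂ M N P v w xs ys (fun a ha => hG a (by simp [ha])) (fun c hc => hC c (by simp [hc]))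
      hxy
    have key : ∀ {K : Type} [Lang.Structure K] (u : α → K) (zs), (BoundedFormula.rel (L := Lang)
        (Rel.equiv j) ts).Realize u zs ↔
          rel j ((ts 0).realize (Sum.elim u zs)) ((ts 1).realize (Sum.elim u zs)) := by
      intro K _ u zs
      refine iff_of_eq (congrArg (Structure.RelMap (L := Lang) (Rel.equiv j)) (funext fun i => ?_))
      fin_cases i <;> rfl
    rw [key, key]
    exact hP.2 _ hs _ ht j le_rfl
  | imp φ ψ ih₁ ih₂ =>
    obtain ⟨k₁, d₁, G₁, C₁, h₁⟩ := ih₁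
    obtain ⟨k₂, d₂, G₂, C₂, h₂⟩ := ih₂
    refine ⟨max k₁ k₂, max d₁ d₂, G₁ ++ G₂, C₁ ++ C₂,
      fun M N _ _ hM hN q P v w xs ys hP hq hG hC hxy => ?_⟩
    rw [realize_imp, realize_imp, h₁ M N hM hN q P v w xs ys (match_mono (le_max_left _ _) hP)
      (by omega) (fun a ha => hG a (by simp [ha])) (fun c hc => hC c (by simp [hc])) hxy,
      h₂ M N hM hN q P v w xs ys (match_mono (le_max_right _ _) hP)
      (by omega) (fun a ha => hG a (by simp [ha])) (fun c hc => hC c (by simp [hc])) hxy]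
  | all φ ih =>
    obtain ⟨k, d, G, C, h⟩ := ih
    refine ⟨k, d + 1, G, C, fun M N _ _ hM hN q P v w xs ys hP hq hG hC hxy => ?_⟩
    have key : ∀ x y, Match (NestedEquiv.rel (M := M)) (NestedEquiv.rel (M := N)) q k ((x, y) :: P) →
        (φ.Realize v (Fin.snoc xs x) ↔ φ.Realize w (Fin.snoc ys y)) := by
      intro x y hxyP
      refine h M N hM hN q _ v w _ _ hxyP (by simp; omega) (fun a ha => by simp [hG a ha])
        (fun c hc => by simp [hC c hc]) fun i => ?_
      -- The new pair heads the list; it uses up one unit of `d`, which bounds the number of pairs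
      -- still to be added.
      refine Fin.lastCases ?_ (fun i => ?_) i
      · simp
      · simp [hxy i]
    rw [realize_all, realize_all]
    constructor
    · intro H y
      obtain ⟨x, hx⟩ := hM.exists_match_cons' hN hP (by omega) y
      exact (key x y hx).1 (H x)
    · intro H x
      obtain ⟨y, hy⟩ := hM.exists_match_cons hN hP (by omega) x
      exact (key x y hy).2 (H y)

/-- In good structures the formulas satisfied by a tuple are determined by the colours of the
elements of the tuple and the equivalences among these and the constants. -/
theorem realize_iff_of_col {α M N : Type} [Lang.Structure M] [Lang.Structure N] (hM : Good M)
    (hN : Good N) (v : α → M) (w : α → N)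
    (hcol : ∀ a q j, col (rel (M := M)) q j (v a) = col (rel (M := N)) q j (w a))
    (hrel : ∀ a b j, rel j (v a) (v b) ↔ rel j (w a) (w b))
    (hcst : ∀ a c j, rel j (v a) (cst M c) ↔ rel j (w a) (cst N c)) (φ : Lang.Formula α) :
    φ.Realize v ↔ φ.Realize w := by
  obtain ⟨k, d, G, C, h⟩ := exists_realize_iff_of_match φ
  -- The list consists of the finitely many variables and constants that matter to `φ`, and the
  -- threshold `q` is its length plus `d`.
  refine h M N hM hN _ (G.map (fun a => (v a, w a)) ++ C.map fun c => (cst M c, cst N c)) v w _ _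
    ⟨fun p hp j _ => ?_, fun p hp p' hp' j _ => ?_⟩ le_rfl
    (fun a ha => List.mem_append_left _ (List.mem_map_of_mem ha))
    (fun c hc => List.mem_append_right _ (List.mem_map_of_mem (f := fun c => (cst M c, cst N c)) hc))
    (fun i => i.elim0)
  · rcases List.mem_append.1 hp with hp | hp <;> obtain ⟨a, -, rfl⟩ := List.mem_map.1 hp
    · exact hcol a _ j
    · exact (hM.col_cst _ j a).trans (hN.col_cst _ j a).symm
  · have hs : ∀ {x y z t}, (rel j x y ↔ rel j z t) → (rel (M := M) j y x ↔ rel (M := N) j t z) :=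
      fun H => ⟨fun h => hN.nested.symm (H.1 (hM.nested.symm h)),
        fun h => hM.nested.symm (H.2 (hN.nested.symm h))⟩
    rcases List.mem_append.1 hp with hp | hp <;> obtain ⟨a, -, rfl⟩ := List.mem_map.1 hp <;>
      rcases List.mem_append.1 hp' with hp' | hp' <;> obtain ⟨b, -, rfl⟩ := List.mem_map.1 hp'
    · exact hrel a b j
    · exact hcst a b j
    · exact hs (hcst b a j)
    · exact (hM.rel_cst j a b).trans (hN.rel_cst j a b).symm

-- Adding an arbitrary nested structure; completeness

/-- The disjoint union of the points and a nested structure. -/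
def sumRel {X : Type} (E : ℕ → X → X → Prop) (j : ℕ) : Point ⊕ X → Point ⊕ X → Prop
  | .inl c, .inl c' => PointE j c c'
  | .inr x, .inr x' => E j x x'
  | _, _ => False

/-- The points and a nested structure, as a structure for the language. -/
def WithPoints {X : Type} (_E : ℕ → X → X → Prop) : Type := Point ⊕ X

instance {X : Type} (E : ℕ → X → X → Prop) : Lang.Structure (WithPoints E) where
  funMap := fun f _ => match f with
    | Func.const c => Sum.inl c
  RelMap := fun r xs => match r with
    | Rel.equiv j => sumRel E j (xs 0) (xs 1)

theorem good_withPoints {X : Type} {E : ℕ → X → X → Prop} (h : Nested E) :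
    Good (WithPoints E) where
  nested :=
    { equiv := fun j => by
        refine ⟨?_, ?_, ?_⟩
        · rintro (c | x)
          exacts [nested_pointE.refl j c, h.refl j x]
        · rintro (c | x) (c' | x') H
          exacts [nested_pointE.symm H, H.elim, H.elim, h.symm H]
        · rintro (c | x) (c' | x') (c'' | x'') H H'
          exacts [nested_pointE.trans H H', H'.elim, H.elim, H.elim, H.elim, H.elim, H'.elim,
            h.trans H H']
      mono_succ := by
        rintro j (c | x) (c' | x') H
        exacts [nested_pointE.mono_succ H, H.elim, H.elim, h.mono_succ H]
      eq_of_zero := by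
        rintro (c | x) (c' | x') H
        exacts [congrArg Sum.inl (nested_pointE.eq_of_zero H), H.elim, H.elim,
          congrArg Sum.inr (h.eq_of_zero H)] }
  rel_cst _ _ _ := Iff.rfl
  closed := by
    rintro j c (c' | x) H
    exacts [⟨c', rfl⟩, H.elim]

/-- An element of the given nested structure. -/
def WithPoints.mk {X : Type} (E : ℕ → X → X → Prop) (x : X) : WithPoints E := Sum.inr x

instance {X : Type} (E : ℕ → X → X → Prop) : Nonempty (WithPoints E) :=
  ⟨cst _ ⟨({0}, 0), 0, by simp⟩⟩

/-- With no free variables the hypotheses of `realize_iff_of_col` are empty, so every model agrees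
with the one formed by the points alone. -/
theorem isComplete_goodTheory : goodTheory.IsComplete := by
  have hg : Good (WithPoints fun _ (x y : Empty) => x = y) :=
    good_withPoints ⟨fun _ => eq_equivalence, fun H => H, fun H => H⟩
  have := hg.model
  refine ⟨Theory.Model.isSatisfiable (WithPoints fun _ (x y : Empty) => x = y), fun φ => ?_⟩
  have key : ∀ M : Theory.ModelType.{0, 0, 0} goodTheory,
      (WithPoints fun _ (x y : Empty) => x = y) ⊨ φ ↔ M ⊨ φ := by
    intro M
    refine (realize_iff_of_col hg (good_of_model M.is_model) default default
      (fun a => a.elim) (fun a => a.elim) (fun a => a.elim) φ)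
  rw [Theory.models_sentence_iff, Theory.models_sentence_iff]
  by_cases H : (WithPoints fun _ (x y : Empty) => x = y) ⊨ φ
  · exact Or.inl fun M => (key M).1 H
  · exact Or.inr fun M => (Sentence.realize_not M).2 fun H' => H ((key M).2 H')

-- Uniformly definable properties

/-- A property of tuples that is defined in all structures by one formula. -/
def Definable {α : Type} (P : ∀ (M : Type) [Lang.Structure M], (α → M) → Prop) : Prop :=
  ∃ φ : Lang.Formula α, ∀ (M : Type) [Lang.Structure M] (v : α → M), φ.Realize v ↔ P M v

namespace Definable

variable {α β : Type}

theorem not {P : ∀ (M : Type) [Lang.Structure M], (α → M) → Prop} (h : Definable P) :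
    Definable fun M _ v => ¬ P M v := by
  obtain ⟨φ, hφ⟩ := h
  exact ⟨φ.not, fun M _ v => not_congr (hφ M v)⟩

theorem and {P Q : ∀ (M : Type) [Lang.Structure M], (α → M) → Prop} (h : Definable P)
    (h' : Definable Q) : Definable fun M _ v => P M v ∧ Q M v := by
  obtain ⟨φ, hφ⟩ := h
  obtain ⟨ψ, hψ⟩ := h'
  exact ⟨φ ⊓ ψ, fun M _ v => Formula.realize_inf.trans (and_congr (hφ M v) (hψ M v))⟩

theorem all_finite [Finite β] {P : β → ∀ (M : Type) [Lang.Structure M], (α → M) → Prop}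
    (h : ∀ b, Definable (P b)) : Definable fun M _ v => ∀ b, P b M v := by
  choose φ hφ using h
  exact ⟨Formula.iInf φ, fun M _ v => Formula.realize_iInf.trans (forall_congr' fun b => hφ b M v)⟩

theorem exists_tuple [Finite β] {P : ∀ (M : Type) [Lang.Structure M], (α ⊕ β → M) → Prop}
    (h : Definable P) : Definable fun M _ v => ∃ y : β → M, P M (Sum.elim v y) := by
  obtain ⟨φ, hφ⟩ := h
  exact ⟨φ.iExs β, fun M _ v => Formula.realize_iExs.trans (exists_congr fun y => hφ M _)⟩

theorem rel (j : ℕ) (a b : α) : Definable fun M _ v => NestedEquiv.rel (M := M) j (v a) (v b) :=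
  ⟨relF j (.var (.inl a)) (.var (.inl b)), fun M _ v => by simp [Formula.Realize]⟩

theorem rel_cst (j : ℕ) (a : α) (c : Point) :
    Definable fun M _ v => NestedEquiv.rel (M := M) j (v a) (cst M c) :=
  ⟨relF j (.var (.inl a)) (cSym c).term, fun M _ v => by simp [Formula.Realize]⟩

/-- There are finitely many colours at each level and counts are at most `q`, so the recursive
definition of `col` unfolds into a single formula. -/
theorem col_eq (q j : ℕ) (γ : Color q j) (a : α) :
    Definable fun M _ v => col (NestedEquiv.rel (M := M)) q j (v a) = γ := by
  induction j generalizing α with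
  | zero => exact ⟨⊤, fun M _ v => iff_of_true (by simp) rfl⟩
  | succ j ih =>
    have key : ∀ (δ : Color q j) (m : Fin (q + 1)), Definable fun M _ (v : α → M) =>
        col (NestedEquiv.rel (M := M)) q (j + 1) (v a) δ m := by
      intro δ m
      have h₁ : Definable fun M _ (v : α ⊕ Fin m → M) => ∀ i : Fin m,
          NestedEquiv.rel (M := M) (j + 1) (v (.inr i)) (v (.inl a)) ∧
            col (NestedEquiv.rel (M := M)) q j (v (.inr i)) = δ :=
        all_finite fun i => (rel _ _ _).and (ih δ (Sum.inr i))
      have h₂ : Definable fun M _ (v : α ⊕ Fin m → M) => ∀ i i' : Fin m,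
          NestedEquiv.rel (M := M) j (v (.inr i)) (v (.inr i')) → i = i' := by
        refine all_finite fun i => all_finite fun i' => ?_
        by_cases hi : i = i'
        · exact ⟨⊤, fun M _ v => iff_of_true (by simp) fun _ => hi⟩
        · obtain ⟨φ, hφ⟩ := (rel j (α := α ⊕ Fin m) (.inr i) (.inr i')).not
          exact ⟨φ, fun M _ v => (hφ M v).trans ⟨fun H H' => (H H').elim, fun H H' => hi (H H')⟩⟩
      exact (h₁.and h₂).exists_tuple
    have : Definable fun M _ (v : α → M) => ∀ (δ : Color q j) (m : Fin (q + 1)),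
        (col (NestedEquiv.rel (M := M)) q (j + 1) (v a) δ m ↔ γ δ m) := by
      refine all_finite fun δ => all_finite fun m => ?_
      by_cases hγ : γ δ m
      · simpa only [hγ, iff_true] using key δ m
      · simpa only [hγ, iff_false] using (key δ m).not
    obtain ⟨φ, hφ⟩ := this
    exact ⟨φ, fun M _ v => (hφ M v).trans
      ⟨fun H => funext fun δ => funext fun m => propext (H δ m), fun H δ m => by rw [H]⟩⟩

/-- Definable properties are preserved by elementary equivalence. -/
theorem congr {P : ∀ (M : Type) [Lang.Structure M], (α → M) → Prop} (h : Definable P)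
    {M N : Type} [Lang.Structure M] [Lang.Structure N] {v : α → M} {w : α → N}
    (hvw : ∀ φ : Lang.Formula α, φ.Realize v ↔ φ.Realize w) : P M v ↔ P N w := by
  obtain ⟨φ, hφ⟩ := h
  rw [← hφ, ← hφ, hvw]

end Definable

-- Counting types: superstability

/-- A complete type over a set of parameters is the type of an element of a good structure that is
elementarily equivalent over the parameters. -/
theorem exists_realization {M : Type} [Lang.Structure M] [Nonempty M] (hM : M ⊨ goodTheory)
    {A : Set M} (p : (Lang[[A]].completeTheory M).CompleteType (Fin 1)) :
    ∃ (N : Type) (_ : Lang.Structure N) (a : A → N) (x : N), Good N ∧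
      (∀ φ : Lang.Formula A, φ.Realize (fun a => (a : M)) ↔ φ.Realize a) ∧
      ∀ ψ : Lang[[A]][[Fin 1]].Sentence, ψ ∈ p ↔
        Formula.Realize (L := Lang) (constantsVarsEquiv (Formula.equivSentence.symm ψ))
          (Sum.elim a fun _ => x) := by
  obtain ⟨N, v, rfl⟩ := Theory.exists_modelType_is_realized_in _ p
  let : Lang.Structure N := (Lang.lhomWithConstants A).reduct N
  have hN : N ⊨ goodTheory := by
    refine (Theory.model_iff _).2 fun φ hφ => ?_
    refine ((Lang.lhomWithConstants A).realize_onSentence N φ).1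
      ((Theory.model_iff _).1 N.is_model _ ?_)
    exact mem_completeTheory.2 (((Lang.lhomWithConstants A).realize_onSentence M φ).2
      ((Theory.model_iff _).1 hM φ hφ))
  refine ⟨N, inferInstance, fun a => (Lang.con a : N), v 0, good_of_model hN, fun φ => ?_,
    fun ψ => ?_⟩
  · have h₁ := Formula.realize_equivSentence N φ
    have h₂ := Formula.realize_equivSentence M φ
    have h₃ : (Formula.equivSentence φ).Realize M ↔ (Formula.equivSentence φ).Realize N := by
      constructor
      · exact fun H => (Theory.model_iff _).1 N.is_model _ (mem_completeTheory.2 H)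
      · intro H
        by_contra H'
        exact (Sentence.realize_not N).1 ((Theory.model_iff _).1 N.is_model _
          (mem_completeTheory.2 ((Sentence.realize_not M).2 H'))) H
    exact h₂.symm.trans (h₃.trans h₁)
  · rw [Theory.CompleteType.mem_typeOf]
    have hv : v = fun _ => v 0 := funext fun i => congrArg v (Subsingleton.elim i 0)
    conv_lhs => rw [hv]
    exact BoundedFormula.realize_constantsVarsEquiv.symm

/-- In a good structure, the equivalences between an element and a family of elements are determined
by a nearest element of the family. -/
theorem exists_nearest {N ι : Type} {E : ℕ → N → N → Prop} (h : Nested E) (x : N) (u : ι → N) :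
    ∃ o : Option (ι × ℕ), ∀ i j, E j x (u i) ↔ ∃ r ∈ o, r.2 ≤ j ∧ E j (u r.1) (u i) := by
  classical
  by_cases hx : ∃ n i, E n x (u i)
  · obtain ⟨i₀, hi₀⟩ := Nat.find_spec hx
    refine ⟨some (i₀, Nat.find hx), fun i j => ?_⟩
    simp only [Option.mem_def, Option.some.injEq, exists_eq_left']
    constructor
    · intro H
      have hj : Nat.find hx ≤ j := Nat.find_min' hx ⟨i, H⟩
      exact ⟨hj, h.trans (h.symm (h.mono hj hi₀)) H⟩
    · rintro ⟨hj, H⟩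
      exact h.trans (h.mono hj hi₀) H
  · refine ⟨none, fun i j => iff_of_false (fun H => hx ⟨j, i, H⟩) ?_⟩
    simp

/-- A type over a set of parameters is determined by the colours of a realization and a nearest
parameter or constant. -/
theorem exists_invariant {M : Type} [Lang.Structure M] [Nonempty M] (hM : M ⊨ goodTheory)
    (A : Set M) : ∃ f : (Lang[[A]].completeTheory M).CompleteType (Fin 1) →
      Option ((A ⊕ Point) × ℕ) × ∀ qj : ℕ × ℕ, Color qj.1 qj.2, Function.Injective f := by
  have hgM := good_of_model hM
  let u : A ⊕ Point → M := Sum.elim (fun a => a) (cst M)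
  have key : ∀ p : (Lang[[A]].completeTheory M).CompleteType (Fin 1),
      ∃ f : Option ((A ⊕ Point) × ℕ) × ∀ qj : ℕ × ℕ, Color qj.1 qj.2,
      ∃ (N : Type) (_ : Lang.Structure N) (a : A → N) (x : N), Good N ∧
      (∀ φ : Lang.Formula A, φ.Realize (fun a => (a : M)) ↔ φ.Realize a) ∧
      (∀ ψ : Lang[[A]][[Fin 1]].Sentence, ψ ∈ p ↔
        Formula.Realize (L := Lang) (constantsVarsEquiv (Formula.equivSentence.symm ψ))
          (Sum.elim a fun _ => x)) ∧
      (∀ i j, rel j x (Sum.elim a (cst N) i) ↔ ∃ r ∈ f.1, r.2 ≤ j ∧ rel j (u r.1) (u i)) ∧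
      ∀ q j, col (rel (M := N)) q j x = f.2 (q, j) := by
    intro p
    obtain ⟨N, _, a, x, hN, ha, hp⟩ := exists_realization hM p
    obtain ⟨o, ho⟩ := exists_nearest hN.nested x (Sum.elim a (cst N))
    refine ⟨(o, fun qj => col rel qj.1 qj.2 x), N, inferInstance, a, x, hN, ha, hp,
      fun i j => (ho i j).trans ?_, fun _ _ => rfl⟩
    refine exists_congr fun r => and_congr_right fun _ => and_congr_right fun _ => ?_
    obtain ⟨r | r, n⟩ := r <;> obtain i | i := i
    · exact ((Definable.rel j r i).congr ha).symm
    · exact ((Definable.rel_cst j r i).congr ha).symm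
    · have := ((Definable.rel_cst j i r).congr ha).symm
      exact ⟨fun H => hgM.nested.symm (this.1 (hN.nested.symm H)),
        fun H => hN.nested.symm (this.2 (hgM.nested.symm H))⟩
    · exact (hN.rel_cst j r i).trans (hgM.rel_cst j r i).symm
  choose f hf using key
  refine ⟨f, fun p p' hpp' => ?_⟩
  obtain ⟨N, _, a, x, hN, ha, hp, hx, hc⟩ := hf p
  obtain ⟨N', _, a', x', hN', ha', hp', hx', hc'⟩ := hf p'
  rw [← hpp'] at hx' hc'
  have hxx : ∀ i j, rel j x (Sum.elim a (cst N) i) ↔ rel j x' (Sum.elim a' (cst N') i) :=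
    fun i j => (hx i j).trans (hx' i j).symm
  have haa : ∀ φ : Lang.Formula A, φ.Realize a ↔ φ.Realize a' :=
    fun φ => (ha φ).symm.trans (ha' φ)
  refine SetLike.ext fun ψ => ?_
  rw [hp, hp']
  refine realize_iff_of_col hN hN' _ _ ?_ ?_ ?_ _
  -- Facts about parameters alone are first-order over `A`, hence shared by both realizations; facts
  -- about `x` and `x'` come from the common invariant.
  · rintro (b | b) q j
    · exact (((Definable.col_eq q j _ b).congr haa).1 rfl).symm
    · exact (hc q j).trans (hc' q j).symm
  · rintro (b | b) (b' | b') j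
    · exact (Definable.rel j b b').congr haa
    · have := hxx (.inl b) j
      exact ⟨fun H => hN'.nested.symm (this.1 (hN.nested.symm H)),
        fun H => hN.nested.symm (this.2 (hN'.nested.symm H))⟩
    · exact hxx (.inl b') j
    · exact iff_of_true (hN.nested.refl j x) (hN'.nested.refl j x')
  · rintro (b | b) c j
    · exact (Definable.rel_cst j b c).congr haa
    · exact hxx (.inr c) j

theorem isSuperstable_goodTheory : goodTheory.IsSuperstable := by
  intro κ hκ M _ _ hM A hA
  have hκ' : 2 ^ ℵ₀ ≤ κ := by rwa [max_eq_left card_lang] at hκ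
  have hκ₀ : ℵ₀ ≤ κ := (Cardinal.cantor _).le.trans hκ'
  obtain ⟨f, hf⟩ := exists_invariant hM A
  refine (Cardinal.mk_le_of_injective hf).trans ?_
  -- A countable product of finite sets; this factor is why `2 ^ ℵ₀` is needed.
  have hcol : #(∀ qj : ℕ × ℕ, Color qj.1 qj.2) ≤ κ := by
    choose g hg using fun qj : ℕ × ℕ => Countable.exists_injective_nat (Color qj.1 qj.2)
    have hinj : Function.Injective fun (s : ∀ qj : ℕ × ℕ, Color qj.1 qj.2) qj => g qj (s qj) :=
      fun s s' H => funext fun qj => hg qj (congrFun H qj)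
    refine (Cardinal.mk_le_of_injective hinj).trans (le_trans ?_ hκ')
    simp
  have hopt : #(Option ((A ⊕ Point) × ℕ)) ≤ κ := by
    have hP : #Point ≤ κ := (Cardinal.mk_le_aleph0).trans hκ₀
    rw [Cardinal.mk_option, Cardinal.mk_prod, Cardinal.mk_sum]
    simp only [Cardinal.lift_id, Cardinal.mk_nat]
    exact Cardinal.add_le_of_le hκ₀ (Cardinal.mul_le_of_le hκ₀ (Cardinal.add_le_of_le hκ₀ hA hP)
      hκ₀) (Cardinal.one_le_aleph0.trans hκ₀)
  rw [Cardinal.mk_prod]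
  simp only [Cardinal.lift_id]
  exact Cardinal.mul_le_of_le hκ₀ hopt hcol

-- Continuum many types over the empty set

/-- Sets of natural numbers, together with the subsets of these. -/
abbrev SetPair : Type := {x : Set ℕ × (ℕ → Bool) // ∀ i, x.2 i = true → i ∈ x.1}

/-- Agreement from an index on, for subsets of the same set. -/
def SetPairE (j : ℕ) (x y : SetPair) : Prop := TailEq j x.1 y.1

theorem nested_setPairE : Nested SetPairE := (nested_tailEq _ _).comap Subtype.val_injective

/-- The empty subset of a given set. -/
def emptyPair (s : Set ℕ) : WithPoints SetPairE :=
  WithPoints.mk SetPairE ⟨(s, fun _ => false), fun _ h => Bool.noConfusion h⟩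

/-- A subset of `s` that agrees with `∅` beyond `i` but not from `i` on must contain `i`; the
witness for `i ∈ s` is `{i}`. -/
theorem exists_rel_emptyPair_iff (s : Set ℕ) (i : ℕ) :
    (∃ y : Fin 1 → WithPoints SetPairE, rel (i + 1) (y 0) (emptyPair s) ∧
      ¬ rel i (y 0) (emptyPair s)) ↔ i ∈ s := by
  constructor
  · rintro ⟨y, h, h'⟩
    generalize y 0 = z at h h'
    obtain c | ⟨⟨t, f⟩, hf⟩ := z
    · exact h.elim
    · obtain ⟨rfl, h⟩ : t = s ∧ ∀ l, i + 1 ≤ l → f l = false := h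
      refine hf i ?_
      by_contra hi
      refine h' ⟨rfl, fun l hl => ?_⟩
      rcases Nat.lt_or_ge i l with hl' | hl'
      · exact h l hl'
      · obtain rfl : l = i := le_antisymm hl' hl
        simpa using hi
  · intro hi
    refine ⟨fun _ => WithPoints.mk SetPairE ⟨(s, fun l => decide (l = i)), fun l hl => ?_⟩, ?_, ?_⟩
    · obtain rfl : l = i := by simpa using hl
      exact hi
    · refine ⟨rfl, fun l hl => ?_⟩
      have : l ≠ i := by omega
      simpa using this
    · rintro ⟨-, h⟩
      simpa using h i le_rfl

theorem not_isOmegaStable_goodTheory : ¬ goodTheory.IsOmegaStable := by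
  intro h
  have := (good_withPoints nested_setPairE).model
  have hle := h (WithPoints SetPairE) ∅ (by simp)
  let T := (Lang[[(∅ : Set (WithPoints SetPairE))]]).completeTheory (WithPoints SetPairE)
  have hinj : Function.Injective fun s : Set ℕ => T.typeOf fun _ : Fin 1 => emptyPair s := by
    intro s t hst
    ext i
    rw [← exists_rel_emptyPair_iff s, ← exists_rel_emptyPair_iff t]
    obtain ⟨φ, hφ⟩ := ((Definable.rel (α := Fin 1 ⊕ Fin 1) (i + 1) (Sum.inr 0) (Sum.inl 0)).and
      (Definable.rel i (Sum.inr 0) (Sum.inl 0)).not).exists_tuple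
    have key : ∀ s : Set ℕ, Formula.equivSentence
        ((Lang.lhomWithConstants (∅ : Set (WithPoints SetPairE))).onFormula φ) ∈
          T.typeOf (fun _ : Fin 1 => emptyPair s) ↔
        ∃ y : Fin 1 → WithPoints SetPairE, rel (i + 1) (y 0) (emptyPair s) ∧
          ¬ rel i (y 0) (emptyPair s) := by
      intro s
      rw [Theory.CompleteType.formula_mem_typeOf, LHom.realize_onFormula]
      exact hφ _ _
    rw [← key, ← key]
    exact iff_of_eq (congrArg (_ ∈ ·) hst)
  have := (Cardinal.mk_le_of_injective hinj).trans hle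
  rw [Cardinal.mk_set, Cardinal.mk_nat] at this
  exact (Cardinal.cantor ℵ₀).not_ge this

-- Trees with classes of three kinds

/-- The kinds of classes in the tree structures below. -/
inductive Label
  | A
  | B
  | C

/-- Sequences that represent elements: the `k`-th entry gives the number and the kind of the class
for the `k`-th relation within the class for the next relation. A class of kind `A` has subclasses
of kind `B`, a class of kind `B` has subclasses of kinds `A` and `B`, and the class of kind `C` has
subclasses of kind `B`, one of kind `C`, and also some of kind `A` at the levels in `D`. -/
structure Allowed (D : Set ℕ) (f : ℕ → ℕ × Label) : Prop where
  of_C : ∀ k, (f k).2 = .C → (f k).1 = 0 ∧ (f (k + 1)).2 = .C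
  of_A : ∀ k, (f k).2 = .A → (f (k + 1)).2 = .B ∨ (f (k + 1)).2 = .C ∧ k ∈ D
  of_A_one : (f 1).2 = .A → (f 0).1 = 0
  eventually_C : ∃ k, ∀ i, k ≤ i → f i = (0, .C)

/-- The sequences that represent elements. -/
abbrev Seq (D : Set ℕ) : Type := {f : ℕ → ℕ × Label // Allowed D f}

/-- Agreement from an index on. -/
def SeqE (D : Set ℕ) (j : ℕ) (x y : Seq D) : Prop := TailEq j ((), x.1) ((), y.1)

theorem nested_seqE (D : Set ℕ) : Nested (SeqE D) :=
  (nested_tailEq Unit (ℕ × Label)).comap (f := fun x : Seq D => ((), x.1))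
    fun _ _ h => Subtype.ext (congrArg Prod.snd h)

theorem seqE_iff {D : Set ℕ} {j : ℕ} {x y : Seq D} :
    SeqE D j x y ↔ ∀ i, j ≤ i → x.1 i = y.1 i :=
  ⟨fun h => h.2, fun h => ⟨rfl, h⟩⟩

/-- The constant sequence of kind `C`. -/
def baseSeq (D : Set ℕ) : Seq D :=
  ⟨fun _ => (0, .C), fun _ _ => ⟨rfl, rfl⟩, fun _ h => Label.noConfusion h,
    fun h => Label.noConfusion h, 0, fun _ _ => rfl⟩

theorem Allowed.eq_of_C {D : Set ℕ} {f : ℕ → ℕ × Label} (h : Allowed D f) {k : ℕ}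
    (hk : (f k).2 = .C) : ∀ i, k ≤ i → f i = (0, .C) := by
  have : ∀ i, k ≤ i → (f i).2 = .C := by
    intro i hi
    induction hi with
    | refl => exact hk
    | step _ ih => exact (h.of_C _ ih).2
  exact fun i hi => Prod.ext (h.of_C i (this i hi)).1 (this i hi)

theorem seqE_baseSeq {D : Set ℕ} {x : Seq D} {k j : ℕ} (hk : (x.1 k).2 = .C) (hkj : k ≤ j) :
    SeqE D j x (baseSeq D) :=
  seqE_iff.2 fun i hi => x.2.eq_of_C hk i (hkj.trans hi)

-- The game for `∀ₙ`-formulas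

/-- The relation between the kinds of two classes for the `k`-th relation under which every
`∀ₙ`-property of the first class holds in the second one. -/
def LabelRel (n k : ℕ) (l l' : Label) : Prop :=
  l = l' ∨ l = .B ∧ l' = .A ∧ n ≤ k ∨ l = .A ∧ l' = .B ∧ n + 1 ≤ k

/-- The two thresholds differ by one so that exchanging sides costs one quantifier block: `B`-to-`A`
for `n + 1` has the same bound on `k` as `A`-to-`B` for `n`, and the other direction has slack. -/
theorem LabelRel.swap {n k : ℕ} {l l' : Label} (h : LabelRel (n + 1) k l l') :
    LabelRel n k l' l := by
  rcases h with rfl | ⟨rfl, rfl, h⟩ | ⟨rfl, rfl, h⟩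
  · exact Or.inl rfl
  · exact Or.inr (Or.inr ⟨rfl, rfl, h⟩)
  · exact Or.inr (Or.inl ⟨rfl, rfl, by omega⟩)

/-- Positions in the game for `∀ₙ`-formulas. -/
structure Position (D D' : Set ℕ) (n : ℕ) (P : List (Seq D × Seq D')) : Prop where
  label : ∀ p ∈ P, ∀ k, LabelRel n k (p.1.1 k).2 (p.2.1 k).2
  seqE : ∀ p ∈ P, ∀ p' ∈ P, ∀ j, SeqE D j p.1 p'.1 ↔ SeqE D' j p.2 p'.2
  base : (baseSeq D, baseSeq D') ∈ P

section

variable {D D' : Set ℕ} {n : ℕ} {P : List (Seq D × Seq D')}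

theorem Position.swap (h : Position D D' (n + 1) P) : Position D' D n (P.map Prod.swap) where
  label := by
    intro p hp k
    obtain ⟨p, hpP, rfl⟩ := List.mem_map.1 hp
    exact (h.label p hpP k).swap
  seqE := by
    intro p hp p' hp' j
    obtain ⟨p, hpP, rfl⟩ := List.mem_map.1 hp
    obtain ⟨p', hpP', rfl⟩ := List.mem_map.1 hp'
    exact (h.seqE p hpP p' hpP' j).symm
  base := List.mem_map_of_mem (f := Prod.swap) h.base

theorem Position.cons (h : Position D D' n P) {x : Seq D} {y : Seq D'}
    (hl : ∀ k, LabelRel n k (x.1 k).2 (y.1 k).2)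
    (hE : ∀ p ∈ P, ∀ j, SeqE D j x p.1 ↔ SeqE D' j y p.2) : Position D D' n ((x, y) :: P) where
  label := by
    intro p hp
    rcases List.mem_cons.1 hp with rfl | hp
    exacts [hl, h.label p hp]
  seqE := by
    intro p hp p' hp' j
    have hN := nested_seqE D
    have hN' := nested_seqE D'
    rcases List.mem_cons.1 hp with rfl | hp <;> rcases List.mem_cons.1 hp' with rfl | hp'
    · exact iff_of_true (hN.refl _ _) (hN'.refl _ _)
    · exact hE p' hp' j
    · exact ⟨fun H => hN'.symm ((hE p hp j).1 (hN.symm H)),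
        fun H => hN.symm ((hE p hp j).2 (hN'.symm H))⟩
    · exact h.seqE p hp p' hp' j
  base := List.mem_cons_of_mem _ h.base

/-- A sequence with the lower part of `y`, the upper part of `x`, and a new entry in between. -/
theorem Allowed.graft {f g : ℕ → ℕ × Label} (hf : Allowed D f) (hg : Allowed D' g) {j r : ℕ}
    {l : Label} (hgC : ∀ k ≤ j, (g k).2 ≠ .C)
    (hl : l = .A ∧ (g j).2 = .A ∧ ((f (j + 1)).2 = .B ∨ (f (j + 1)).2 = .C ∧ j ∈ D) ∨ l = .B)
    (h0 : j = 0 → (f 1).2 ≠ .A) :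
    Allowed D fun i => if i < j then g i else if i = j then (r, l) else f i where
  of_C k hk := by
    rcases lt_trichotomy k j with hkj | rfl | hkj
    · simp only [hkj, if_true] at hk
      exact (hgC k hkj.le hk).elim
    · simp only [lt_irrefl, if_true, if_false] at hk
      subst hk
      simp at hl
    · have h₁ : ¬ k < j := by omega
      have h₂ : k ≠ j := by omega
      have h₃ : ¬ k + 1 < j := by omega
      have h₄ : k + 1 ≠ j := by omega
      simp only [h₁, h₂, h₃, h₄, if_false] at hk ⊢
      exact hf.of_C k hk
  of_A k hk := by
    rcases lt_trichotomy k j with hkj | rfl | hkj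
    · simp only [hkj, if_true] at hk
      have hB : (g (k + 1)).2 = .B := (hg.of_A k hk).resolve_right fun h => hgC _ hkj h.1
      left
      rcases Nat.lt_or_ge (k + 1) j with hkj' | hkj'
      · simpa only [hkj', if_true] using hB
      · obtain rfl : j = k + 1 := by omega
        simp only [lt_irrefl, if_true, if_false]
        -- The entry just below the new one has kind `A`, so the new one must be `B`; it can be `A`
        -- only where `g` has `A`, which is excluded here.
        rcases hl with ⟨-, hA, -⟩ | hl
        · rw [hB] at hA
          exact Label.noConfusion hA
        · exact hl
    · simp only [lt_irrefl, if_true, if_false] at hk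
      subst hk
      simp only [reduceCtorEq, or_false, true_and] at hl
      simpa using hl.2
    · have h₁ : ¬ k < j := by omega
      have h₂ : k ≠ j := by omega
      have h₃ : ¬ k + 1 < j := by omega
      have h₄ : k + 1 ≠ j := by omega
      simp only [h₁, h₂, h₃, h₄, if_false] at hk ⊢
      exact hf.of_A k hk
  of_A_one hA := by
    rcases Nat.lt_trichotomy j 1 with hj | rfl | hj
    · obtain rfl : j = 0 := by omega
      exact (h0 rfl (by simpa using hA)).elim
    · simp only [lt_irrefl, if_true, if_false] at hA
      subst hA
      simp only [reduceCtorEq, or_false, true_and] at hl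
      simpa using hg.of_A_one hl.1
    · have : 0 < j := by omega
      simp only [hj, this, if_true] at hA ⊢
      exact hg.of_A_one hA
  eventually_C := by
    obtain ⟨k, hk⟩ := hf.eventually_C
    refine ⟨max k (j + 1), fun i hi => ?_⟩
    have h₁ : ¬ i < j := by omega
    have h₂ : i ≠ j := by omega
    simp only [h₁, h₂, if_false]
    exact hk i (by omega)

/-- A move in the game for `∀ₙ`-formulas can be answered. -/
theorem Position.exists_cons (h : Position D D' (n + 1) P) (hD : ∀ j ∈ D', n + 1 ≤ j)
    (y : Seq D') : ∃ x, Position D D' (n + 1) ((x, y) :: P) := by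
  classical
  have hN := nested_seqE D
  have hN' := nested_seqE D'
  have hex : ∃ j, ∃ p ∈ P, SeqE D' j y p.2 := by
    obtain ⟨k, hk⟩ := y.2.eventually_C
    exact ⟨k, _, h.base, seqE_iff.2 hk⟩
  obtain ⟨p, hp, hyp⟩ := Nat.find_spec hex
  have hmin : ∀ i < Nat.find hex, ∀ p' ∈ P, ¬ SeqE D' i y p'.2 := fun i hi p' hp' H =>
    Nat.find_min hex hi ⟨p', hp', H⟩
  generalize Nat.find hex = j at hyp hmin
  cases j with
  | zero =>
    obtain rfl := hN'.eq_of_zero hyp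
    exact ⟨p.1, h.cons (h.label p hp) fun p' hp' => h.seqE p hp p' hp'⟩
  | succ j =>
    -- An entry of kind `C` would make `y` equivalent to the base sequence, which is in the list, at
    -- too low a level.
    have hyC : ∀ k ≤ j, (y.1 k).2 ≠ .C := fun k hk hC =>
      hmin j (by omega) _ h.base (seqE_baseSeq hC hk)
    have hyt := seqE_iff.1 hyp
    -- A number not used at level `j` keeps the answer out of all listed classes there.
    obtain ⟨r, hr⟩ : ∃ r, ∀ p' ∈ P, (p'.1.1 j).1 ≠ r := by
      obtain ⟨r, hr⟩ := Infinite.exists_notMem_finset (P.map fun p' => (p'.1.1 j).1).toFinset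
      exact ⟨r, fun p' hp' H => hr (List.mem_toFinset.2 (List.mem_map.2 ⟨p', hp', H⟩))⟩
    -- The kind of `y` at level `j` is copied if the class above on the left admits it. Otherwise
    -- `B` answers `A`, which needs `n + 1 ≤ j`: this follows from an `A`-to-`B` mismatch at level
    -- `j + 1`, or from `hD` when the class above `y` has kind `C`.
    obtain ⟨l, hl, hll⟩ : ∃ l : Label, (l = .A ∧ (y.1 j).2 = .A ∧ ((p.1.1 (j + 1)).2 = .B ∨
        (p.1.1 (j + 1)).2 = .C ∧ j ∈ D) ∨ l = .B) ∧ LabelRel (n + 1) j l (y.1 j).2 := by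
      cases hy : (y.1 j).2 with
      | C => exact (hyC j le_rfl hy).elim
      | B => exact ⟨.B, Or.inr rfl, Or.inl rfl⟩
      | A =>
        by_cases hs : (p.1.1 (j + 1)).2 = .B ∨ (p.1.1 (j + 1)).2 = .C ∧ j ∈ D
        · exact ⟨.A, Or.inl ⟨rfl, rfl, hs⟩, Or.inl rfl⟩
        · refine ⟨.B, Or.inr rfl, Or.inr (Or.inl ⟨rfl, rfl, ?_⟩)⟩
          have hlab := h.label p hp (j + 1)
          rw [← hyt (j + 1) le_rfl] at hlab
          rcases y.2.of_A j hy with hB | ⟨-, hj⟩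
          · rw [hB] at hlab
            rcases hlab with H | ⟨-, H, -⟩ | ⟨-, -, H⟩
            · exact (hs (Or.inl H)).elim
            · exact Label.noConfusion H
            · omega
          · exact hD j hj
    -- At level 1, `A` can only be matched with `A`, and such a class is a singleton, so a new
    -- element inside it is impossible.
    have h0 : j = 0 → (p.1.1 1).2 ≠ .A := by
      rintro rfl hA
      have hlab := h.label p hp 1
      rw [hA] at hlab
      rcases hlab with H | ⟨H, -, -⟩ | ⟨-, -, H⟩
      · have key : ∀ z : Seq D', (z.1 1).2 = .A → z.1 0 = (0, .B) := by
          intro z hz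
          refine Prod.ext (z.2.of_A_one hz) ?_
          cases hz' : (z.1 0).2 with
          | A => rcases z.2.of_A 0 hz' with H | ⟨H, -⟩ <;> simp [hz] at H
          | B => rfl
          | C => have := (z.2.of_C 0 hz').2; simp [hz] at this
        refine hmin 0 (by omega) p hp (seqE_iff.2 fun i _ => ?_)
        rcases Nat.eq_zero_or_pos i with rfl | hi
        · rw [key y (by rw [hyt 1 le_rfl]; exact H.symm), key p.2 H.symm]
        · exact hyt i hi
      · exact Label.noConfusion H
      · omega
    refine ⟨⟨_, p.1.2.graft y.2 (r := r) hyC hl h0⟩, h.cons (fun k => ?_) fun p' hp' i => ?_⟩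
    · rcases lt_trichotomy k j with hkj | rfl | hkj
      · simp only [hkj, if_true]
        exact Or.inl rfl
      · simpa only [lt_irrefl, if_true, if_false] using hll
      · have h₁ : ¬ k < j := by omega
        have h₂ : k ≠ j := by omega
        simp only [h₁, h₂, if_false]
        rw [hyt k hkj]
        exact h.label p hp k
    · rcases Nat.lt_or_ge j i with hi | hi
      · rw [hN'.congr_left (hN'.mono (Nat.succ_le_of_lt hi) hyp), ← h.seqE p hp p' hp' i]
        refine hN.congr_left (seqE_iff.2 fun k hk => ?_)
        have h₁ : ¬ k < j := by omega
        have h₂ : k ≠ j := by omega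
        simp only [h₁, h₂, if_false]
      · refine iff_of_false (fun H => hr p' hp' ?_) (hmin i (by omega) p' hp')
        have := seqE_iff.1 H j hi
        simp only [lt_irrefl, if_true, if_false] at this
        exact (congrArg Prod.fst this).symm

end

/-- The structure of the allowed sequences. -/
abbrev SeqModel (D : Set ℕ) : Type := WithPoints (SeqE D)

/-- The new constant names the base sequence, the realization of the type under study. -/
instance (D : Set ℕ) : (constantsOn (Fin 1)).Structure (SeqModel D) :=
  constantsOn.structure fun _ => WithPoints.mk (SeqE D) (baseSeq D)

/-- The pairs of elements of the two structures that are given by a position. -/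
def Linked {D D' : Set ℕ} (P : List (Seq D × Seq D')) (x : SeqModel D) (y : SeqModel D') : Prop :=
  (∃ c, x = cst _ c ∧ y = cst _ c) ∨ ∃ p ∈ P, x = WithPoints.mk _ p.1 ∧ y = WithPoints.mk _ p.2

section

variable {D D' : Set ℕ} {n : ℕ} {P : List (Seq D × Seq D')}

theorem Linked.swap {x : SeqModel D} {y : SeqModel D'} (h : Linked P x y) :
    Linked (P.map Prod.swap) y x := by
  rcases h with ⟨c, hx, hy⟩ | ⟨p, hp, hx, hy⟩
  · exact Or.inl ⟨c, hy, hx⟩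
  · exact Or.inr ⟨p.swap, List.mem_map_of_mem hp, hy, hx⟩

theorem Position.rel_iff (h : Position D D' n P) {x₁ x₂ : SeqModel D} {y₁ y₂ : SeqModel D'}
    (h₁ : Linked P x₁ y₁) (h₂ : Linked P x₂ y₂) (j : ℕ) : rel j x₁ x₂ ↔ rel j y₁ y₂ := by
  rcases h₁ with ⟨c, rfl, rfl⟩ | ⟨p, hp, rfl, rfl⟩ <;>
    rcases h₂ with ⟨c', rfl, rfl⟩ | ⟨p', hp', rfl, rfl⟩
  · exact Iff.rfl
  · exact Iff.rfl
  · exact Iff.rfl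
  · exact h.seqE p hp p' hp' j

theorem Position.eq_iff (h : Position D D' n P) {x₁ x₂ : SeqModel D} {y₁ y₂ : SeqModel D'}
    (h₁ : Linked P x₁ y₁) (h₂ : Linked P x₂ y₂) : x₁ = x₂ ↔ y₁ = y₂ := by
  have key : ∀ {E} (x y : SeqModel E), x = y ↔ rel 0 x y := fun {E} x y =>
    ⟨fun H => H ▸ (good_withPoints (nested_seqE E)).nested.refl 0 x,
      (good_withPoints (nested_seqE E)).nested.eq_of_zero⟩
  rw [key, key]
  exact h.rel_iff h₁ h₂ 0

theorem Position.linked_term (h : Position D D' n P) {l : ℕ} (xs : Fin l → SeqModel D)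
    (ys : Fin l → SeqModel D') (hxy : ∀ i, Linked P (xs i) (ys i))
    (t : Lang[[Fin 1]].Term (Empty ⊕ Fin l)) :
    Linked P (t.realize (Sum.elim default xs)) (t.realize (Sum.elim default ys)) := by
  cases t with
  | var i =>
    rcases i with i | i
    · exact i.elim
    · exact hxy i
  | @func m f ts =>
    rcases f with f | f
    · obtain ⟨c⟩ := f
      exact Or.inl ⟨c, rfl, rfl⟩
    · cases m with
      | zero => exact Or.inr ⟨_, h.base, rfl, rfl⟩
      | succ m => exact isEmptyElim f

theorem Position.realize_iff_of_isQF (h : Position D D' n P) {l : ℕ} {xs : Fin l → SeqModel D}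
    {ys : Fin l → SeqModel D'} (hxy : ∀ i, Linked P (xs i) (ys i))
    {φ : Lang[[Fin 1]].BoundedFormula Empty l} (hφ : φ.IsQF) :
    φ.Realize default xs ↔ φ.Realize default ys := by
  induction hφ with
  | falsum => exact Iff.rfl
  | of_isAtomic ha =>
    cases ha with
    | equal t₁ t₂ =>
      rw [realize_bdEqual, realize_bdEqual]
      exact h.eq_iff (h.linked_term xs ys hxy t₁) (h.linked_term xs ys hxy t₂)
    | rel R ts =>
      rcases R with R | R
      · obtain ⟨j⟩ := R
        exact h.rel_iff (h.linked_term xs ys hxy (ts 0)) (h.linked_term xs ys hxy (ts 1)) j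
      · exact isEmptyElim R
  | imp _ _ ih₁ ih₂ => rw [realize_imp, realize_imp, ih₁, ih₂]

theorem Position.exists_linked (h : Position D D' (n + 1) P) (hD : ∀ j ∈ D', n + 1 ≤ j) {l : ℕ}
    {xs : Fin l → SeqModel D} {ys : Fin l → SeqModel D'} (hxy : ∀ i, Linked P (xs i) (ys i))
    (y : SeqModel D') : ∃ x Q, Position D D' (n + 1) Q ∧
      ∀ i, Linked Q (Fin.snoc (α := fun _ => SeqModel D) xs x i)
        (Fin.snoc (α := fun _ => SeqModel D') ys y i) := by
  obtain ⟨c, rfl⟩ | ⟨y, rfl⟩ : (∃ c, y = cst _ c) ∨ ∃ z, y = WithPoints.mk _ z := by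
    obtain c | z := y
    exacts [Or.inl ⟨c, rfl⟩, Or.inr ⟨z, rfl⟩]
  · refine ⟨cst _ c, P, h, fun i => ?_⟩
    refine Fin.lastCases ?_ (fun i => ?_) i
    · simp only [Fin.snoc_last]
      exact Or.inl ⟨c, rfl, rfl⟩
    · simpa only [Fin.snoc_castSucc] using hxy i
  · obtain ⟨x, hx⟩ := h.exists_cons hD y
    refine ⟨WithPoints.mk _ x, _, hx, fun i => ?_⟩
    refine Fin.lastCases ?_ (fun i => ?_) i
    · simp only [Fin.snoc_last]
      exact Or.inr ⟨(x, y), List.mem_cons_self, rfl, rfl⟩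
    · simp only [Fin.snoc_castSucc]
      rcases hxy i with H | ⟨p, hp, H⟩
      · exact Or.inl H
      · exact Or.inr ⟨p, List.mem_cons_of_mem _ hp, H⟩

end

/-- `∀ₙ`-formulas are preserved from the left to the right of a position, and `∃ₙ`-formulas from the
right to the left. -/
theorem Position.realize_imp (n : ℕ) :
    (∀ (l : ℕ) (φ : Lang[[Fin 1]].BoundedFormula Empty l), IsForallLevel n l φ →
      ∀ (D D' : Set ℕ) (P : List (Seq D × Seq D')) (xs : Fin l → SeqModel D)
        (ys : Fin l → SeqModel D'), Position D D' n P → (∀ j ∈ D, n ≤ j) → (∀ j ∈ D', n ≤ j) →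
        (∀ i, Linked P (xs i) (ys i)) → φ.Realize default xs → φ.Realize default ys) ∧
    (∀ (l : ℕ) (φ : Lang[[Fin 1]].BoundedFormula Empty l), IsExistsLevel n l φ →
      ∀ (D D' : Set ℕ) (P : List (Seq D × Seq D')) (xs : Fin l → SeqModel D)
        (ys : Fin l → SeqModel D'), Position D D' n P → (∀ j ∈ D, n ≤ j) → (∀ j ∈ D', n ≤ j) →
        (∀ i, Linked P (xs i) (ys i)) → φ.Realize default ys → φ.Realize default xs) := by
  induction n with
  | zero =>
    constructor <;> intro l φ hφ D D' P xs ys hP _ _ hxy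
    · unfold IsForallLevel at hφ
      exact (hP.realize_iff_of_isQF hxy hφ).1
    · unfold IsExistsLevel at hφ
      exact (hP.realize_iff_of_isQF hxy hφ).2
  | succ n ih =>
    constructor <;> intro l φ hφ
    · unfold IsForallLevel at hφ
      induction hφ with
      | base hφ =>
        intro D D' P xs ys hP hD hD' hxy
        -- When the block is exhausted, an `∃ₙ`-formula remains; it is preserved from right to left,
        -- so the sides are exchanged.
        exact ih.2 _ _ hφ D' D _ ys xs hP.swap (fun j hj => (Nat.le_succ n).trans (hD' j hj))
          (fun j hj => (Nat.le_succ n).trans (hD j hj)) fun i => (hxy i).swap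
      | all _ ih' =>
        intro D D' P xs ys hP hD hD' hxy H
        rw [realize_all] at H ⊢
        intro y
        obtain ⟨x, Q, hQ, hxy'⟩ := hP.exists_linked hD' hxy y
        exact ih' D D' Q _ _ hQ hD hD' hxy' (H x)
    · unfold IsExistsLevel at hφ
      induction hφ with
      | base hφ =>
        intro D D' P xs ys hP hD hD' hxy
        exact ih.1 _ _ hφ D' D _ ys xs hP.swap (fun j hj => (Nat.le_succ n).trans (hD' j hj))
          (fun j hj => (Nat.le_succ n).trans (hD j hj)) fun i => (hxy i).swap
      | ex _ ih' =>
        intro D D' P xs ys hP hD hD' hxy H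
        rw [realize_ex] at H ⊢
        obtain ⟨y, hy⟩ := H
        obtain ⟨x, Q, hQ, hxy'⟩ := hP.exists_linked hD' hxy y
        exact ⟨x, ih' D D' Q _ _ hQ hD hD' hxy' hy⟩

-- Formulas that separate the kinds, and the unbounded type

/-- The property that distinguishes the classes of kind `A` from those of kind `B`. -/
def Alternating {M : Type} [Lang.Structure M] : ℕ → M → Prop
  | 0, x => ∀ y, rel 1 y x → rel 0 y x
  | k + 1, x => ∀ y, rel (k + 2) y x → ¬ Alternating k y

theorem Definable.forall_elem {α : Type} {P : ∀ (M : Type) [Lang.Structure M], (α ⊕ Unit → M) → Prop}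
    (h : Definable P) : Definable fun M _ v => ∀ y : M, P M (Sum.elim v fun _ => y) := by
  obtain ⟨φ, hφ⟩ := h.not.exists_tuple.not
  refine ⟨φ, fun M _ v => (hφ M v).trans ?_⟩
  simp only [not_exists, not_not]
  exact ⟨fun H y => H _, fun H y => H (y ())⟩

theorem Definable.imp {α : Type} {P Q : ∀ (M : Type) [Lang.Structure M], (α → M) → Prop}
    (h : Definable P) (h' : Definable Q) : Definable fun M _ v => P M v → Q M v := by
  obtain ⟨φ, hφ⟩ := h
  obtain ⟨ψ, hψ⟩ := h'
  exact ⟨φ.imp ψ, fun M _ v => Formula.realize_imp.trans (imp_congr (hφ M v) (hψ M v))⟩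

theorem Definable.alternating {α : Type} (k : ℕ) (a : α) :
    Definable fun M _ v => Alternating (M := M) k (v a) := by
  induction k generalizing α with
  | zero =>
    exact ((Definable.rel 1 (Sum.inr ()) (Sum.inl a)).imp
      (Definable.rel 0 (Sum.inr ()) (Sum.inl a))).forall_elem
  | succ k ih =>
    exact ((Definable.rel (k + 2) (Sum.inr ()) (Sum.inl a)).imp (ih (Sum.inr ())).not).forall_elem

/-- The element of the given structure represented by a sequence. -/
abbrev Seq.elem {D : Set ℕ} (x : Seq D) : SeqModel D := WithPoints.mk (SeqE D) x

/-- A subclass of a class. -/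
theorem exists_subclass {D : Set ℕ} (x : Seq D) (k r : ℕ) (hx : (x.1 (k + 1)).2 ≠ .A) {l : Label}
    (hl : l = .A ∧ ((x.1 (k + 1)).2 = .B ∨ (x.1 (k + 1)).2 = .C ∧ k ∈ D) ∨ l = .B) :
    ∃ y : Seq D, SeqE D (k + 1) y x ∧ y.1 k = (r, l) := by
  -- Filling up with `(0, .B)` below `k` is always allowed; the number 0 respects `of_A_one` when `k
  -- = 1`, and for `k = 0` that clause is avoided by `hx`.
  refine ⟨⟨fun i => if i < k then (0, .B) else if i = k then (r, l) else x.1 i, ?_, ?_, ?_, ?_⟩,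
    ?_, ?_⟩
  · intro i hi
    rcases lt_trichotomy i k with hik | rfl | hik
    · simp [hik] at hi
    · simp only [lt_irrefl, if_true, if_false] at hi
      subst hi
      simp at hl
    · have h₁ : ¬ i < k := by omega
      have h₂ : i ≠ k := by omega
      have h₃ : ¬ i + 1 < k := by omega
      have h₄ : i + 1 ≠ k := by omega
      simp only [h₁, h₂, h₃, h₄, if_false] at hi ⊢
      exact x.2.of_C i hi
  · intro i hi
    rcases lt_trichotomy i k with hik | rfl | hik
    · simp [hik] at hi
    · simp only [lt_irrefl, if_true, if_false] at hi
      subst hi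
      simpa using hl
    · have h₁ : ¬ i < k := by omega
      have h₂ : i ≠ k := by omega
      have h₃ : ¬ i + 1 < k := by omega
      have h₄ : i + 1 ≠ k := by omega
      simp only [h₁, h₂, h₃, h₄, if_false] at hi ⊢
      exact x.2.of_A i hi
  · intro h
    rcases Nat.eq_zero_or_pos k with rfl | hk
    · simp at h
      exact (hx h).elim
    · simp [hk]
  · obtain ⟨m, hm⟩ := x.2.eventually_C
    refine ⟨max m (k + 1), fun i hi => ?_⟩
    have h₁ : ¬ i < k := by omega
    have h₂ : i ≠ k := by omega
    simp only [h₁, h₂, if_false]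
    exact hm i (by omega)
  · refine seqE_iff.2 fun i hi => ?_
    have h₁ : ¬ i < k := by omega
    have h₂ : i ≠ k := by omega
    simp only [h₁, h₂, if_false]
  · simp

theorem label_eq_B_of_succ_eq_A {D : Set ℕ} (x : Seq D) {k : ℕ} (h : (x.1 (k + 1)).2 = .A) :
    (x.1 k).2 = .B := by
  cases hk : (x.1 k).2 with
  | A => rcases x.2.of_A k hk with H | ⟨H, -⟩ <;> rw [h] at H <;> exact Label.noConfusion H
  | B => rfl
  | C =>
    have H := (x.2.of_C k hk).2
    rw [h] at H
    exact Label.noConfusion H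

/-- At level 1, kind `A` means singleton. Above that, a class of kind `A` has only subclasses of
kind `B`, whereas one of kind `B` also has a subclass of kind `A`. `Alternating k` concerns the
class at level `k + 1`. -/
theorem alternating_iff {D : Set ℕ} (k : ℕ) (x : Seq D) :
    ((x.1 (k + 1)).2 = .A → Alternating k x.elem) ∧
      ((x.1 (k + 1)).2 = .B → ¬ Alternating k x.elem) := by
  induction k generalizing x with
  | zero =>
    constructor
    · rintro hA (c | y) H
      · exact H.elim
      · have hy := (seqE_iff (D := D)).1 H
        refine (seqE_iff (D := D)).2 fun i _ => ?_
        rcases Nat.eq_zero_or_pos i with rfl | hi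
        · have hyA : (y.1 1).2 = .A := by rw [hy 1 le_rfl]; exact hA
          exact Prod.ext ((y.2.of_A_one hyA).trans (x.2.of_A_one hA).symm)
            ((label_eq_B_of_succ_eq_A y hyA).trans (label_eq_B_of_succ_eq_A x hA).symm)
        · exact hy i hi
    · intro hB H
      -- A different number at level 0 gives a second element of the class.
      obtain ⟨y, hy, hy'⟩ := exists_subclass x 0 ((x.1 0).1 + 1) (by rw [hB]; simp) (Or.inr rfl)
      have := (seqE_iff (D := D)).1 (H y.elem hy) 0 le_rfl
      rw [hy'] at this
      have := congrArg Prod.fst this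
      simp at this
  | succ k ih =>
    constructor
    · rintro hA (c | y) H
      · exact H.elim
      · have hyA : (y.1 (k + 2)).2 = .A := by
          rw [(seqE_iff (D := D)).1 H (k + 2) le_rfl]
          exact hA
        exact (ih y).2 (label_eq_B_of_succ_eq_A y hyA)
    · intro hB H
      obtain ⟨y, hy, hy'⟩ := exists_subclass x (k + 1) 0 (l := .A) (by rw [hB]; simp)
        (Or.inl ⟨rfl, Or.inl hB⟩)
      exact H y.elem hy ((ih y).1 (by rw [hy']))

/-- The property of an element that the class of the `(k + 2)`-th relation has a new subclass of
kind `A`. -/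
def HasSubclassA {M : Type} [Lang.Structure M] (k : ℕ) (x : M) : Prop :=
  ∃ y : Unit → M, (rel (k + 2) (y ()) x ∧ ¬ rel (k + 1) (y ()) x) ∧ Alternating k (y ())

theorem Definable.hasSubclassA {α : Type} (k : ℕ) (a : α) :
    Definable fun M _ v => HasSubclassA (M := M) k (v a) :=
  (((Definable.rel (k + 2) (Sum.inr ()) (Sum.inl a)).and
    (Definable.rel (k + 1) (Sum.inr ()) (Sum.inl a)).not).and
      (Definable.alternating k (Sum.inr ()))).exists_tuple

/-- Within the class of the base sequence at level `k + 2`, a subclass other than its own has kind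
`A` or `B`; `Alternating k` excludes `B`, and kind `A` below kind `C` is what `D` controls. -/
theorem hasSubclassA_baseSeq_iff (D : Set ℕ) (k : ℕ) :
    HasSubclassA k (baseSeq D).elem ↔ k + 1 ∈ D := by
  constructor
  · rintro ⟨y, ⟨h₁, h₂⟩, h₃⟩
    generalize y () = z at h₁ h₂ h₃
    obtain c | z := z
    · exact h₁.elim
    · have hC : (z.1 (k + 2)).2 = .C := by rw [(seqE_iff (D := D)).1 h₁ (k + 2) le_rfl]; rfl
      cases hz : (z.1 (k + 1)).2 with
      | A =>
        rcases z.2.of_A _ hz with H | ⟨-, H⟩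
        · rw [hC] at H
          exact Label.noConfusion H
        · exact H
      | B => exact ((alternating_iff k z).2 hz h₃).elim
      | C => exact (h₂ (seqE_baseSeq hz le_rfl)).elim
  · intro h
    obtain ⟨y, hy, hy'⟩ := exists_subclass (baseSeq D) (k + 1) 0 (l := .A)
      (fun H => Label.noConfusion H) (Or.inl ⟨rfl, Or.inr ⟨rfl, h⟩⟩)
    refine ⟨fun _ => y.elem, ⟨hy, fun H => ?_⟩, (alternating_iff k y).1 (by rw [hy'])⟩
    have := (seqE_iff (D := D)).1 H (k + 1) le_rfl
    rw [hy'] at this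
    exact Label.noConfusion (congrArg Prod.snd this)

/-- The constant sequence of kind `C` realizes an unbounded type. -/
theorem exists_not_isBounded :
    ∃ p : goodTheory.CompleteType (Fin 1), ¬ p.toTheory.IsBounded := by
  have hM : SeqModel ∅ ⊨ goodTheory := (good_withPoints (nested_seqE ∅)).model
  refine ⟨goodTheory.typeOf fun _ => (baseSeq ∅).elem, ?_⟩
  change ¬ (Lang[[Fin 1]].completeTheory (SeqModel ∅)).IsBounded
  rintro ⟨n, Γ, hΓ, hΓ₁, hΓ₂⟩
  -- The level `n + 1` is high enough for the `∀ₙ`-game starting from the pair of base sequences,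
  -- and it is the level that `HasSubclassA n` tests.
  have hNΓ : SeqModel {n + 1} ⊨ Γ := by
    refine (Theory.model_iff _).2 fun φ hφ => ?_
    have hφM : SeqModel ∅ ⊨ φ := (hΓ₁ φ hφ).realize_sentence (SeqModel ∅)
    refine (Position.realize_imp n).1 0 φ (hΓ φ hφ) ∅ {n + 1} [(baseSeq _, baseSeq _)] default
      default ⟨?_, ?_, by simp⟩ (fun j hj => hj.elim) (fun j hj => ?_) (fun i => i.elim0) hφM
    · intro p hp k
      obtain rfl := List.mem_singleton.1 hp
      exact Or.inl rfl
    · intro p hp p' hp' j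
      obtain rfl := List.mem_singleton.1 hp
      obtain rfl := List.mem_singleton.1 hp'
      exact iff_of_true ((nested_seqE _).refl _ _) ((nested_seqE _).refl _ _)
    · rw [Set.mem_singleton_iff.1 hj]
      exact Nat.le_succ n
  obtain ⟨φ, hφ⟩ := (Definable.hasSubclassA n (0 : Fin 1)).not
  have key : ∀ D : Set ℕ, SeqModel D ⊨ Formula.equivSentence φ ↔ n + 1 ∉ D := by
    intro D
    refine (Formula.realize_equivSentence (SeqModel D) φ).trans ?_
    exact (hφ (SeqModel D) _).trans (not_congr (hasSubclassA_baseSeq_iff D n))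
  have h := (hΓ₂ _ (mem_completeTheory.2 ((key ∅).2 (fun H => H)))).realize_sentence
    (SeqModel {n + 1})
  exact (key {n + 1}).1 h rfl

end NestedEquiv

theorem mainTheorem1 :
    ∃ (L : FirstOrder.Language.{0, 0}) (T : L.Theory),
      L.card ≤ Cardinal.aleph0 ∧
      T.IsComplete ∧
      T.IsBounded ∧
      T.IsForallAxiomatizable 1 ∧
      (∃ p : T.CompleteType (Fin 1), ¬ p.toTheory.IsBounded) ∧
      T.IsSuperstable ∧
      ¬ T.IsOmegaStable := by
  refine ⟨NestedEquiv.Lang, NestedEquiv.goodTheory, NestedEquiv.card_lang,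
    NestedEquiv.isComplete_goodTheory, ⟨1, NestedEquiv.isForallAxiomatizable_goodTheory⟩,
    NestedEquiv.isForallAxiomatizable_goodTheory, NestedEquiv.exists_not_isBounded,
    NestedEquiv.isSuperstable_goodTheory, NestedEquiv.not_isOmegaStable_goodTheory⟩
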